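/- Model. Let $n\ge 2$ and $0\le t\le n-1$. There are $n$ processes, computing in synchronous rounds (round $m+1$ lies between times $m$ and $m+1$); in each round a process acts (possibly decides) according to its local state, then sends messages to the other processes, then receives messages. An adversary $\alpha$ consists of initial values $v_1,\dots,v_n\in\{0,1\}$ and a crash failure pattern in which at most $t$ processes crash: a process crashing in round $c\ge 1$ behaves correctly in rounds $1,\dots,c-1$, succeeds in sending on an arbitrary subset of its links in round $c$, and sends nothing afterwards. It is active at time $m$ if it does not crash in a round $\le m$; it is correct if it never crashes; $f$ is the number of processes that crash in $\alpha$. A deterministic protocol $P$ and an adversary $\alpha$ determine a run $P[\alpha]$. A protocol solves uniform consensus if in each of its runs (i) every correct process decides, (ii) if all initial values are $v$ then the correct processes decide $v$, and (iii) all processes that decide (correct or not) decide on the same value. A protocol $Q$ dominates $P$ if, for all adversaries $\alpha$ and processes $i$, whenever $i$ decides in $P[\alpha]$ at some time $m$, it decides in $Q[\alpha]$ at some time $m'\le m$; $Q$ strictly dominates $P$ if moreover $P$ does not dominate $Q$. $P$ is an unbeatable uniform consensus protocol if it solves uniform consensus and no protocol solving uniform consensus strictly dominates it. In a full-information protocol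 every process maintains its view and in each round sends it to all others; the protocol is determined by its decision rule, which depends on the view. Here the view $G(i,0)$ is the node $\langle i,0\rangle$ labelled $v_i$, and $G(i,m+1)$ is the union of the node $\langle i,m+1\rangle$, of the views $G(j,m)$, and of the edges $(\langle j,m\rangle,\langle i,m+1\rangle)$, over $j=i$ and all $j$ whose round-$(m+1)$ message reaches $i$. The local state of an active process consists of the time, its current decision status and its view; all crashed processes have one and the same local state. $K_iA$ ("$i$ knows $A$") holds at time $m$ of a run of $P$ if the fact $A$ holds at time $m$ in every run of $P$ in which $i$ has the same local state at time $m$. $\exists 0$ is the fact that some initial value is $0$, and $\exists\mathsf{correct}(0)$ is the fact that $K_j\exists 0$ holds for some correct process $j$. A node $\langle j,k\rangle$ is revealed to $\langle i,m\rangle$ if it is a node of $G(i,m)$, or if $k\ge1$ and there is a node $\langle i',k\rangle$ of $G(i,m)$ such that $(\langle j,k-1\rangle,\langle i',k\rangle)$ is not an edge of $G(i,m)$. Time $k$ is revealed to $\langle i,m\rangle$ if $\langle j,k\rangle$ is revealed to $\langle i,m\rangle$ for all processes $j$. u-Opt$_0$ is the full-information protocol with the following rule for an active undecided process $i$ at time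 $m$, where knowledge is evaluated in the set of runs of the protocol itself: if $K_i\exists\mathsf{correct}(0)$ then decide $0$; else, if $\neg K_i\exists 0$ and some time $k\le m$ is revealed to $\langle i,m\rangle$, then decide $1$; otherwise do not decide. Theorem. There is a full-information protocol implementing u-Opt$_0$, and every full-information protocol implementing it is an unbeatable uniform consensus protocol. Moreover, in each of its runs, all decisions are made by time $f+2$ at the latest, and if $f\ge t-1$, then all decisions are made by time $f+1$ at the latest. (All decisions are made by time $T$ if no process decides later than $T$ and every process active at time $T$ has decided by then.) -/

import Mathlib

/-! Synchronous message passing with crash failures, uniform consensus, knowledge, and the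
knowledge-based protocol `u-Opt₀`. Round `m + 1` takes place between time `m` and time `m + 1`. -/

/-- A crash failure pattern on `n` processes: a layered graph together with the crashing rounds.
`edge i m j` is the edge from the node `(i, m)` to the node `(j, m + 1)`: a message that `i` sends
to `j` in round `m + 1` would be delivered. The value `crashRound i = ⊤` means that `i` never
crashes. In its crashing round a process may succeed on an arbitrary subset of its links. -/
structure FailurePattern (n : ℕ) where
  edge : Fin n → ℕ → Fin n → Prop
  crashRound : Fin n → ℕ∞
  one_le_crashRound : ∀ i, 1 ≤ crashRound i
  edge_before : ∀ i m j, ((m + 1 : ℕ) : ℕ∞) < crashRound i → edge i m j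
  no_edge_after : ∀ i m j, crashRound i < ((m + 1 : ℕ) : ℕ∞) → ¬ edge i m j

/-- An adversary: an input vector and a failure pattern. -/
structure Adversary (n : ℕ) where
  input : Fin n → Fin 2
  pattern : FailurePattern n

namespace Adversary

variable {n : ℕ}

/-- `i` never crashes. -/
def Correct (α : Adversary n) (i : Fin n) : Prop := α.pattern.crashRound i = ⊤

/-- `i` is active at time `m`: it does not crash before time `m`, i.e. in a round `≤ m`. -/
def Active (α : Adversary n) (i : Fin n) (m : ℕ) : Prop := (m : ℕ∞) < α.pattern.crashRound i

/-- The number `f` of processes that actually fail. -/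
noncomputable def numFailures (α : Adversary n) : ℕ := {i | ¬ α.Correct i}.ncard

end Adversary

/-- The crash failure context: all binary inputs, at most `t` crash failures. -/
def crashContext (n t : ℕ) : Set (Adversary n) := {α | α.numFailures ≤ t}

/-- A deterministic protocol. At each time a process may perform a decision and sends messages (or
nothing) to the other processes, depending on its local state; its next state depends on its state
and on the messages received. In `step i s msgs`, `msgs j` is the message received from `j`. -/
structure Protocol (n : ℕ) where
  State : Type
  Msg : Type
  init : Fin n → Fin 2 → State
  decide : Fin n → State → Option (Fin 2)
  send : Fin n → State → Fin n → Option Msg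
  step : Fin n → State → (Fin n → Option Msg) → State

namespace Protocol

variable {n : ℕ}

open Classical in
/-- The states in the run of `P` against `α` (meaningful as long as the process is active). -/
noncomputable def state (P : Protocol n) (α : Adversary n) : ℕ → Fin n → P.State
  | 0, i => P.init i (α.input i)
  | m + 1, i => P.step i (P.state α m i) fun j =>
      if j ≠ i ∧ α.pattern.edge j m i then P.send j (P.state α m j) i else none

open Classical in
/-- The local state of `i` at time `m` in the run of `P` against `α`; `none` is the uninformative
"crashed" state. -/
noncomputable def localState (P : Protocol n) (α : Adversary n) (m : ℕ) (i : Fin n) :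
    Option P.State :=
  if α.Active i m then some (P.state α m i) else none

/-- In the run of `P` against `α`, process `i` decides `v` at time `m`. A process decides at most
once: only its first decision action counts. -/
def DecidesAt (P : Protocol n) (α : Adversary n) (i : Fin n) (m : ℕ) (v : Fin 2) : Prop :=
  α.Active i m ∧ P.decide i (P.state α m i) = some v ∧
    ∀ k < m, P.decide i (P.state α k i) = none

/-- `P` solves uniform consensus in the context with at most `t` crash failures: the clauses are
Decision, Validity and Uniform Agreement. -/
def SolvesUniformConsensus (P : Protocol n) (t : ℕ) : Prop :=
  ∀ α ∈ crashContext n t,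
    (∀ i, α.Correct i → ∃ m v, P.DecidesAt α i m v) ∧
    (∀ v, (∀ i, α.input i = v) → ∀ i, α.Correct i → ∃ m, P.DecidesAt α i m v) ∧
    (∀ i j m m' v v', P.DecidesAt α i m v → P.DecidesAt α j m' v' → v = v')

/-- `Q` dominates `P`: whenever a process decides in `P`, it decides in `Q` no later. -/
def Dominates (t : ℕ) (Q P : Protocol n) : Prop :=
  ∀ α ∈ crashContext n t, ∀ i m v, P.DecidesAt α i m v → ∃ m' ≤ m, ∃ v', Q.DecidesAt α i m' v'

def StrictlyDominates (t : ℕ) (Q P : Protocol n) : Prop :=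
  Dominates t Q P ∧ ¬ Dominates t P Q

/-- `P` solves uniform consensus, and no protocol that solves it strictly dominates `P`. -/
def IsUnbeatableUniformConsensus (P : Protocol n) (t : ℕ) : Prop :=
  P.SolvesUniformConsensus t ∧
    ¬ ∃ Q : Protocol n, Q.SolvesUniformConsensus t ∧ StrictlyDominates t Q P

/-- In the run of `P` against `α` all decisions are made by time `T`: no process decides later, and
every process that is active at time `T` has decided by then. -/
def AllDecisionsBy (P : Protocol n) (α : Adversary n) (T : ℕ) : Prop :=
  (∀ i m v, P.DecidesAt α i m v → m ≤ T) ∧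
    ∀ i, α.Active i T → ∃ m ≤ T, ∃ v, P.DecidesAt α i m v

/-- `P.Knows t i A α m`: in the system of all runs of `P` with at most `t` crash failures, process
`i` knows the fact `A` at time `m` of the run against `α`. -/
def Knows (P : Protocol n) (t : ℕ) (i : Fin n) (A : Adversary n → ℕ → Prop) (α : Adversary n)
    (m : ℕ) : Prop :=
  ∀ β ∈ crashContext n t, P.localState β m i = P.localState α m i → A β m

end Protocol

/-- The fact "some process has initial value `v`". -/
def ExistsValue {n : ℕ} (v : Fin 2) (α : Adversary n) (_ : ℕ) : Prop := ∃ j, α.input j = v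

/-- The fact "some correct process knows that some process has initial value `v`". -/
def ExistsCorrect {n : ℕ} (P : Protocol n) (t : ℕ) (v : Fin 2) (α : Adversary n) (m : ℕ) : Prop :=
  ∃ j, α.Correct j ∧ P.Knows t j (ExistsValue v) α m

/-- A labelled communication graph: its nodes are pairs (process, time), and `(j, v) ∈ labels`
says that the initial node `(j, 0)` is labelled with the initial value `v`. -/
@[ext]
structure CommGraph (n : ℕ) where
  nodes : Set (Fin n × ℕ)
  edges : Set ((Fin n × ℕ) × (Fin n × ℕ))
  labels : Set (Fin n × Fin 2)

namespace CommGraph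

variable {n : ℕ}

/-- The view at the node `(i, 0)`. -/
def initial (i : Fin n) (v : Fin 2) : CommGraph n where
  nodes := {(i, 0)}
  edges := ∅
  labels := {(i, v)}

/-- The view at the node `(i, m + 1)`, from the view `G` at `(i, m)` and the views `msgs j` received
in round `m + 1`: their union, the new node, and the edges from `(i, m)` and all senders. -/
def extend (i : Fin n) (m : ℕ) (G : CommGraph n) (msgs : Fin n → Option (CommGraph n)) :
    CommGraph n where
  nodes := {(i, m + 1)} ∪ G.nodes ∪ {x | ∃ j, ∃ H ∈ msgs j, x ∈ H.nodes}
  edges := {((i, m), (i, m + 1))} ∪ {e | ∃ j, (msgs j).isSome ∧ e = ((j, m), (i, m + 1))} ∪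
    G.edges ∪ {e | ∃ j, ∃ H ∈ msgs j, e ∈ H.edges}
  labels := G.labels ∪ {x | ∃ j, ∃ H ∈ msgs j, x ∈ H.labels}

/-- The node `(j, k)` is revealed to the holder of the view `G`: either it is seen, or `G` proves
that `j` crashed before time `k ≥ 1`, because some seen node at time `k` did not hear from `j`. -/
def NodeRevealed (G : CommGraph n) (j : Fin n) (k : ℕ) : Prop :=
  (j, k) ∈ G.nodes ∨ ∃ l, k = l + 1 ∧ ∃ i, (i, k) ∈ G.nodes ∧ ((j, l), (i, k)) ∉ G.edges

/-- Time `k` is revealed to the holder of the view `G`. -/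
def TimeRevealed (G : CommGraph n) (k : ℕ) : Prop := ∀ j, G.NodeRevealed j k

end CommGraph

/-- The local state of a process in a full-information protocol: the time, the status of its
decision before acting at that time (`none` if undecided), and its communication graph. -/
structure FipState (n : ℕ) where
  time : ℕ
  status : Option (Fin 2)
  view : CommGraph n

/-- The full-information protocol in which an undecided process `i` whose view at time `m` is `G`
performs the decision action `D i m G`: every process always sends its view to all others. -/
def fullInfo {n : ℕ} (D : Fin n → ℕ → CommGraph n → Option (Fin 2)) : Protocol n where
  State := FipState n
  Msg := CommGraph n
  init i v := ⟨0, none, CommGraph.initial i v⟩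
  decide i s := if s.status = none then D i s.time s.view else none
  send _ s _ := some s.view
  step i s msgs := ⟨s.time + 1, s.status.or (D i s.time s.view), s.view.extend i s.time msgs⟩

/-- The full-information protocol with decision rule `D` is an implementation of the program
`u-Opt₀`: at every point of its own system of runs, an active undecided process `i` decides `0` if
it knows that some correct process knows of an initial value `0`; else decides `1` if it does not
know of an initial value `0` and some time `k ≤ m` is revealed to it; and else does not decide. -/
def IsUOptZero {n : ℕ} (t : ℕ) (D : Fin n → ℕ → CommGraph n → Option (Fin 2)) : Prop :=
  ∀ α ∈ crashContext n t, ∀ i m, α.Active i m →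
    ∀ s : FipState n, s = (fullInfo D).state α m i → s.status = none →
      (D i m s.view = some 0 ↔
        (fullInfo D).Knows t i (ExistsCorrect (fullInfo D) t 0) α m) ∧
      (D i m s.view = some 1 ↔
        ¬ (fullInfo D).Knows t i (ExistsCorrect (fullInfo D) t 0) α m ∧
        ¬ (fullInfo D).Knows t i (ExistsValue 0) α m ∧ ∃ k ≤ m, s.view.TimeRevealed k)

/-! In a full-information protocol the knowledge tests of `u-Opt₀` are properties of views alone, so
an implementation exists. Agreement: a decision on 0 means that some correct process has seen a 0,
whereas a view without 0 to which a time `k` is revealed excludes that any process active at or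
after time `k` has seen one. Decision times: if times 0, ..., m-1 all have nodes hidden from `(i,
m)`, these belong to `m` distinct faulty processes. So at time f+1 some time is revealed; a process
still undecided has then seen a 0, and one round later it has relayed it to a correct process.

Unbeatability: let `Q` solve the problem and dominate the protocol. Then `Q` decides as soon as
`KnowsCorrectZero` holds (`ZeroPrompt`). It cannot decide 0 earlier: the faulty processes might fall
silent, and the correct ones would see a run with all inputs 1 (`knowsCorrectZero_of_decidesAt`). A
premature decision on 1 is refuted by an indistinguishable run in which 0 is decided. The engine is
`decidesZero_of_knowsZero`: if the failures leave slack and a correct process ever sees a 0, then 0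
is decided. It is proved by a chain of runs ending with all inputs 0, where neighbouring runs look
alike to a process that must already have decided (`decidesZero_of_view`). It is applied in two
situations: the process has seen a 0 that may be known to faulty processes only
(`not_decidesAt_one_of_knowsZero`), or every time has a hidden node, and a 0 may travel unseen along
the hidden nodes (`not_decidesAt_one_of_hidden`). -/

namespace Adversary

/-! ### Views in the full-information exchange, and crash patterns. -/

variable {n : ℕ}

open Classical in
/-- The communication graph of process `i` at time `m` in the full-information exchange. -/
noncomputable def view (α : Adversary n) : ℕ → Fin n → CommGraph n
  | 0, i => CommGraph.initial i (α.input i)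
  | m + 1, i => (view α m i).extend i m fun j =>
      if j ≠ i ∧ α.pattern.edge j m i then some (view α m j) else none

/-- `(j, k)` is a node of the view of `(i, m)`. -/
def Sees (α : Adversary n) (i : Fin n) (m : ℕ) (j : Fin n) (k : ℕ) : Prop :=
  (j, k) ∈ (α.view m i).nodes

/-- The view of `(i, m)` contains an initial node with value `0`. -/
def KnowsZero (α : Adversary n) (m : ℕ) (i : Fin n) : Prop :=
  ∃ j, (j, 0) ∈ (α.view m i).labels

theorem mem_nodes_zero {α : Adversary n} {i : Fin n} {x : Fin n × ℕ} :
    x ∈ (α.view 0 i).nodes ↔ x = (i, 0) := by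
  simp [view, CommGraph.initial]

theorem mem_nodes_succ {α : Adversary n} {m : ℕ} {i : Fin n} {x : Fin n × ℕ} :
    x ∈ (α.view (m + 1) i).nodes ↔ x = (i, m + 1) ∨ x ∈ (α.view m i).nodes ∨
      ∃ j, j ≠ i ∧ α.pattern.edge j m i ∧ x ∈ (α.view m j).nodes := by
  simp [view, CommGraph.extend, or_assoc, and_assoc]

theorem mem_edges_zero {α : Adversary n} {i : Fin n} {e : (Fin n × ℕ) × (Fin n × ℕ)} :
    e ∉ (α.view 0 i).edges := by
  simp [view, CommGraph.initial]

theorem mem_edges_succ {α : Adversary n} {m : ℕ} {i : Fin n} {e : (Fin n × ℕ) × (Fin n × ℕ)} :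
    e ∈ (α.view (m + 1) i).edges ↔
      (∃ j, (j = i ∨ (j ≠ i ∧ α.pattern.edge j m i)) ∧ e = ((j, m), (i, m + 1))) ∨
      e ∈ (α.view m i).edges ∨
      ∃ j, j ≠ i ∧ α.pattern.edge j m i ∧ e ∈ (α.view m j).edges := by
  simp only [view, CommGraph.extend, Set.mem_union, Set.mem_singleton_iff, Set.mem_ofPred_eq]
  constructor
  · rintro (((h | ⟨j, hj, h⟩) | h) | ⟨j, H, hH, h⟩)
    · exact .inl ⟨i, .inl rfl, h⟩
    · refine .inl ⟨j, .inr ?_, h⟩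
      by_contra hc
      simp [hc] at hj
    · exact .inr (.inl h)
    · split_ifs at hH with hc
      · obtain rfl : α.view m j = H := by simpa using hH
        exact .inr (.inr ⟨j, hc.1, hc.2, h⟩)
      · simp at hH
  · rintro (⟨j, rfl | hj, h⟩ | h | ⟨j, h1, h2, h⟩)
    · exact .inl (.inl (.inl h))
    · exact .inl (.inl (.inr ⟨j, by simp [hj], h⟩))
    · exact .inl (.inr h)
    · exact .inr ⟨j, α.view m j, by simp [h1, h2], h⟩

theorem mem_labels_zero {α : Adversary n} {i : Fin n} {x : Fin n × Fin 2} :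
    x ∈ (α.view 0 i).labels ↔ x = (i, α.input i) := by
  simp [view, CommGraph.initial]

theorem mem_labels_succ {α : Adversary n} {m : ℕ} {i : Fin n} {x : Fin n × Fin 2} :
    x ∈ (α.view (m + 1) i).labels ↔ x ∈ (α.view m i).labels ∨
      ∃ j, j ≠ i ∧ α.pattern.edge j m i ∧ x ∈ (α.view m j).labels := by
  simp [view, CommGraph.extend, and_assoc]

theorem sees_le {α : Adversary n} {m : ℕ} {i j : Fin n} {k : ℕ} (h : α.Sees i m j k) : k ≤ m := by
  induction m generalizing i with
  | zero => simp [Sees, mem_nodes_zero] at h; omega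
  | succ m ih =>
    rcases mem_nodes_succ.1 h with h | h | ⟨x, -, -, h⟩
    · simp at h; omega
    · exact (ih h).trans (by omega)
    · exact (ih h).trans (by omega)

theorem sees_self (α : Adversary n) (i : Fin n) {m k : ℕ} (hk : k ≤ m) : α.Sees i m i k := by
  induction m with
  | zero => obtain rfl : k = 0 := by omega
            exact mem_nodes_zero.2 rfl
  | succ m ih =>
    rcases Nat.lt_or_ge m k with h | h
    · obtain rfl : k = m + 1 := by omega
      exact mem_nodes_succ.2 (.inl rfl)
    · exact mem_nodes_succ.2 (.inr (.inl (ih h)))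

theorem sees_at {α : Adversary n} {m : ℕ} {i j : Fin n} (h : α.Sees i m j m) : j = i := by
  cases m with
  | zero => simpa [Sees, mem_nodes_zero] using h
  | succ m =>
    rcases mem_nodes_succ.1 h with h | h | ⟨x, -, -, h⟩
    · simpa using h
    · exact absurd (sees_le h) (by omega)
    · exact absurd (sees_le h) (by omega)

theorem sees_pred {α : Adversary n} {m : ℕ} {i j : Fin n} {k : ℕ} (h : α.Sees i m j (k + 1)) :
    α.Sees i m j k := by
  induction m generalizing i with
  | zero => simp [Sees, mem_nodes_zero] at h
  | succ m ih =>
    rcases mem_nodes_succ.1 h with h | h | ⟨x, h1, h2, h⟩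
    · simp only [Prod.mk.injEq] at h
      obtain ⟨rfl, h⟩ := h
      exact α.sees_self j (by omega)
    · exact mem_nodes_succ.2 (.inr (.inl (ih h)))
    · exact mem_nodes_succ.2 (.inr (.inr ⟨x, h1, h2, ih h⟩))

theorem sees_of_edge {α : Adversary n} {m : ℕ} {i j x : Fin n} {k : ℕ}
    (h : α.Sees i m j (k + 1)) (hx : x ≠ j) (he : α.pattern.edge x k j) : α.Sees i m x k := by
  induction m generalizing i with
  | zero => simp [Sees, mem_nodes_zero] at h
  | succ m ih =>
    rcases mem_nodes_succ.1 h with h | h | ⟨y, h1, h2, h⟩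
    · simp only [Prod.mk.injEq] at h
      obtain ⟨rfl, h⟩ := h
      obtain rfl : k = m := by omega
      exact mem_nodes_succ.2 (.inr (.inr ⟨x, hx, he, α.sees_self x le_rfl⟩))
    · exact mem_nodes_succ.2 (.inr (.inl (ih h)))
    · exact mem_nodes_succ.2 (.inr (.inr ⟨y, h1, h2, ih h⟩))

theorem edges_sound {α : Adversary n} {m : ℕ} {i x y : Fin n} {k l : ℕ}
    (h : ((x, k), (y, l)) ∈ (α.view m i).edges) :
    l = k + 1 ∧ (x ≠ y → α.pattern.edge x k y) := by
  induction m generalizing i with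
  | zero => exact absurd h mem_edges_zero
  | succ m ih =>
    rcases mem_edges_succ.1 h with ⟨j, hj, h⟩ | h | ⟨j, -, -, h⟩
    · simp only [Prod.mk.injEq] at h
      obtain ⟨⟨rfl, rfl⟩, rfl, rfl⟩ := h
      refine ⟨rfl, fun hne => ?_⟩
      rcases hj with h | h
      · exact absurd h hne
      · exact h.2
    · exact ih h
    · exact ih h

theorem edges_complete {α : Adversary n} {m : ℕ} {i x y : Fin n} {k : ℕ}
    (h : α.Sees i m y (k + 1)) (he : x ≠ y → α.pattern.edge x k y) :
    ((x, k), (y, k + 1)) ∈ (α.view m i).edges := by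
  induction m generalizing i with
  | zero => simp [Sees, mem_nodes_zero] at h
  | succ m ih =>
    rcases mem_nodes_succ.1 h with h | h | ⟨z, h1, h2, h⟩
    · simp only [Prod.mk.injEq] at h
      obtain ⟨rfl, h⟩ := h
      obtain rfl : k = m := by omega
      refine mem_edges_succ.2 (.inl ⟨x, ?_, rfl⟩)
      by_cases hx : x = y
      · exact .inl hx
      · exact .inr ⟨hx, he hx⟩
    · exact mem_edges_succ.2 (.inr (.inl (ih h)))
    · exact mem_edges_succ.2 (.inr (.inr ⟨z, h1, h2, ih h⟩))

theorem mem_edges_iff {α : Adversary n} {m : ℕ} {i x y : Fin n} {k : ℕ}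
    (h : α.Sees i m y (k + 1)) (hx : x ≠ y) :
    ((x, k), (y, k + 1)) ∈ (α.view m i).edges ↔ α.pattern.edge x k y :=
  ⟨fun he => (edges_sound he).2 hx, fun he => edges_complete h fun _ => he⟩

theorem labels_sound {α : Adversary n} {m : ℕ} {i x : Fin n} {v : Fin 2}
    (h : (x, v) ∈ (α.view m i).labels) : α.input x = v := by
  induction m generalizing i with
  | zero => simp only [mem_labels_zero, Prod.mk.injEq] at h; rw [h.1, h.2]
  | succ m ih =>
    rcases mem_labels_succ.1 h with h | ⟨j, -, -, h⟩
    · exact ih h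
    · exact ih h

theorem labels_complete {α : Adversary n} {m : ℕ} {i x : Fin n} (h : α.Sees i m x 0) :
    (x, α.input x) ∈ (α.view m i).labels := by
  induction m generalizing i with
  | zero => simp only [Sees, mem_nodes_zero, Prod.mk.injEq] at h
            simp [mem_labels_zero, h.1]
  | succ m ih =>
    rcases mem_nodes_succ.1 h with h | h | ⟨z, h1, h2, h⟩
    · simp at h
    · exact mem_labels_succ.2 (.inl (ih h))
    · exact mem_labels_succ.2 (.inr ⟨z, h1, h2, ih h⟩)

theorem view_succ_congr {α β : Adversary n} {m : ℕ} {i : Fin n} (hself : α.view m i = β.view m i)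
    (hedge : ∀ j, j ≠ i → (α.pattern.edge j m i ↔ β.pattern.edge j m i))
    (hview : ∀ j, j ≠ i → α.pattern.edge j m i → α.view m j = β.view m j) :
    α.view (m + 1) i = β.view (m + 1) i := by
  classical
  rw [view, view, hself]
  congr 1
  funext j
  by_cases hj : j ≠ i
  · by_cases he : α.pattern.edge j m i
    · rw [if_pos ⟨hj, he⟩, if_pos ⟨hj, (hedge j hj).1 he⟩, hview j hj he]
    · rw [if_neg (fun h => he h.2), if_neg (fun h => he ((hedge j hj).2 h.2))]
  · rw [if_neg (fun h => hj h.1), if_neg (fun h => hj h.1)]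

/-- Views agree on every set of nodes that is closed under the past and on which the inputs and
the incoming edges agree. -/
theorem view_eq_of_closed {α β : Adversary n} (S : ℕ → Fin n → Prop)
    (hinput : ∀ i, S 0 i → α.input i = β.input i)
    (hself : ∀ m i, S (m + 1) i → S m i)
    (hedge : ∀ m i j, S (m + 1) i → j ≠ i → (α.pattern.edge j m i ↔ β.pattern.edge j m i))
    (hprev : ∀ m i j, S (m + 1) i → j ≠ i → α.pattern.edge j m i → S m j) {m : ℕ} {i : Fin n}
    (hS : S m i) : α.view m i = β.view m i := by
  induction m generalizing i with
  | zero => rw [view, view, hinput i hS]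
  | succ m ih =>
    exact view_succ_congr (ih (hself m i hS)) (fun j => hedge m i j hS)
      fun j hj he => ih (hprev m i j hS hj he)

/-- The view of a node determines the views of all nodes in it. -/
theorem view_eq_of_sees {α β : Adversary n} {m : ℕ} {i : Fin n} (h : α.view m i = β.view m i)
    {k : ℕ} {x : Fin n} (hx : α.Sees i m x k) : α.view k x = β.view k x := by
  have hs : ∀ {x k}, α.Sees i m x k → β.Sees i m x k := fun {x k} hx => by
    unfold Sees at hx ⊢; rwa [← h]
  refine view_eq_of_closed (fun k x => α.Sees i m x k) ?_ (fun k x => sees_pred) ?_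
    (fun k x y => sees_of_edge) hx
  · intro x hx
    have h1 := labels_complete (hs hx)
    rw [← h] at h1
    exact labels_sound h1
  · intro k x y hx hy
    rw [← mem_edges_iff hx hy, ← mem_edges_iff (hs hx) hy, h]

theorem view_eq_of_le {α β : Adversary n} {m : ℕ} {i : Fin n} (h : α.view m i = β.view m i)
    {k : ℕ} (hk : k ≤ m) : α.view k i = β.view k i :=
  view_eq_of_sees h (α.sees_self i hk)

theorem edge_iff_of_view {α β : Adversary n} {m : ℕ} {i : Fin n}
    (h : α.view (m + 1) i = β.view (m + 1) i) {j : Fin n} (hj : j ≠ i) :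
    α.pattern.edge j m i ↔ β.pattern.edge j m i := by
  rw [← mem_edges_iff (α.sees_self i le_rfl) hj, ← mem_edges_iff (β.sees_self i le_rfl) hj, h]

theorem view_eq_of_edge {α β : Adversary n} {m : ℕ} {i : Fin n}
    (h : α.view (m + 1) i = β.view (m + 1) i) {j : Fin n} (hj : j ≠ i)
    (he : α.pattern.edge j m i) : α.view m j = β.view m j :=
  view_eq_of_sees h (sees_of_edge (α.sees_self i le_rfl) hj he)

theorem knowsZero_congr {α β : Adversary n} {m : ℕ} {i : Fin n} (h : α.view m i = β.view m i) :
    α.KnowsZero m i ↔ β.KnowsZero m i := by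
  unfold KnowsZero; rw [h]

theorem knowsZero_zero {α : Adversary n} {i : Fin n} : α.KnowsZero 0 i ↔ α.input i = 0 := by
  simp [KnowsZero, mem_labels_zero, eq_comm]

theorem knowsZero_succ {α : Adversary n} {m : ℕ} {i : Fin n} :
    α.KnowsZero (m + 1) i ↔
      α.KnowsZero m i ∨ ∃ j, j ≠ i ∧ α.pattern.edge j m i ∧ α.KnowsZero m j := by
  simp only [KnowsZero, mem_labels_succ]
  constructor
  · rintro ⟨x, h | ⟨j, h1, h2, h⟩⟩
    · exact .inl ⟨x, h⟩
    · exact .inr ⟨j, h1, h2, x, h⟩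
  · rintro (⟨x, h⟩ | ⟨j, h1, h2, x, h⟩)
    · exact ⟨x, .inl h⟩
    · exact ⟨x, .inr ⟨j, h1, h2, h⟩⟩

theorem KnowsZero.mono {α : Adversary n} {m k : ℕ} {i : Fin n} (h : α.KnowsZero k i)
    (hk : k ≤ m) : α.KnowsZero m i := by
  induction hk with
  | refl => exact h
  | step _ ih => exact knowsZero_succ.2 (.inl ih)

theorem KnowsZero.edge {α : Adversary n} {m : ℕ} {i j : Fin n} (h : α.KnowsZero m j)
    (he : α.pattern.edge j m i) : α.KnowsZero (m + 1) i := by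
  by_cases hj : j = i
  · subst hj; exact h.mono (by omega)
  · exact knowsZero_succ.2 (.inr ⟨j, hj, he, h⟩)

theorem KnowsZero.of_sees {α : Adversary n} {m k : ℕ} {i j : Fin n} (h : α.KnowsZero k j)
    (hs : α.Sees i m j k) : α.KnowsZero m i := by
  induction m generalizing i with
  | zero =>
    simp only [Sees, mem_nodes_zero, Prod.mk.injEq] at hs
    obtain ⟨rfl, rfl⟩ := hs
    exact h
  | succ m ih =>
    rcases mem_nodes_succ.1 hs with hs | hs | ⟨x, -, hx, hs⟩
    · simp only [Prod.mk.injEq] at hs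
      obtain ⟨rfl, rfl⟩ := hs
      exact h
    · exact (ih hs).mono (by omega)
    · exact (ih hs).edge hx

theorem KnowsZero.exists_input {α : Adversary n} {m : ℕ} {i : Fin n} (h : α.KnowsZero m i) :
    ∃ j, α.input j = 0 :=
  h.imp fun _ => labels_sound

theorem active_of_edge {α : Adversary n} {m : ℕ} {i j : Fin n} (h : α.pattern.edge i m j) :
    α.Active i m := by
  by_contra hc
  refine α.pattern.no_edge_after i m j (lt_of_le_of_lt (not_lt.1 hc) ?_) h
  exact_mod_cast Nat.lt_succ_self m

theorem edge_of_active {α : Adversary n} {m : ℕ} {i : Fin n} (h : α.Active i (m + 1)) (j : Fin n) :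
    α.pattern.edge i m j :=
  α.pattern.edge_before i m j h

theorem Active.of_le {α : Adversary n} {m k : ℕ} {i : Fin n} (h : α.Active i m) (hk : k ≤ m) :
    α.Active i k :=
  lt_of_le_of_lt (by exact_mod_cast hk) h

theorem Correct.active {α : Adversary n} {i : Fin n} (h : α.Correct i) (m : ℕ) : α.Active i m := by
  unfold Active; rw [h]; exact ENat.natCast_lt_top m

theorem Correct.edge {α : Adversary n} {i : Fin n} (h : α.Correct i) (m : ℕ) (j : Fin n) :
    α.pattern.edge i m j :=
  edge_of_active (h.active _) j

theorem active_zero (α : Adversary n) (i : Fin n) : α.Active i 0 :=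
  lt_of_lt_of_le (by simp) (α.pattern.one_le_crashRound i)

/-- After a missing message the sender sends nothing and is not active. -/
theorem not_active_of_not_edge {α : Adversary n} {m k : ℕ} {i j : Fin n}
    (h : ¬ α.pattern.edge i m j) (hk : m < k) : ¬ α.Active i k :=
  fun ha => h (edge_of_active (ha.of_le hk) j)

theorem not_correct_of_not_edge {α : Adversary n} {m : ℕ} {i j : Fin n}
    (h : ¬ α.pattern.edge i m j) : ¬ α.Correct i :=
  fun hc => h (hc.edge m j)

theorem not_edge_of_not_edge {α : Adversary n} {m k : ℕ} {i j x : Fin n}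
    (h : ¬ α.pattern.edge i m j) (hk : m < k) : ¬ α.pattern.edge i k x :=
  fun he => not_active_of_not_edge h hk (active_of_edge he)

/-- The adversary with the same failure pattern and all inputs equal to `v`. -/
def constInput (α : Adversary n) (v : Fin 2) : Adversary n := ⟨fun _ => v, α.pattern⟩

/-- The nodes that have seen no 0 form a set closed under the past, and all inputs on it are 1. -/
theorem view_constInput_one {α : Adversary n} {m : ℕ} {i : Fin n} (h : ¬ α.KnowsZero m i) :
    α.view m i = (α.constInput 1).view m i := by
  refine view_eq_of_closed (α := α) (β := α.constInput 1) (fun m i => ¬ α.KnowsZero m i) ?_ ?_ (fun _ _ _ _ _ => Iff.rfl) ?_ h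
  · intro i hi
    rw [knowsZero_zero] at hi
    change α.input i = 1
    omega
  · exact fun m i hi h => hi (h.mono (by omega))
  · exact fun m i j hi _ he h => hi (h.edge he)

theorem exists_correct_of_ncard_lt {α : Adversary n} {s : Set (Fin n)}
    (hs : (s ∪ {i | ¬ α.Correct i}).ncard < n) : ∃ i, α.Correct i ∧ i ∉ s := by
  by_contra! hc
  have : s ∪ {i | ¬ α.Correct i} = Set.univ := by
    ext i
    simp only [Set.mem_union, Set.mem_ofPred_eq, Set.mem_univ, iff_true]
    by_cases h : α.Correct i
    · exact .inl (hc i h)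
    · exact .inr h
  rw [this, Set.ncard_univ, Nat.card_eq_fintype_card, Fintype.card_fin] at hs
  exact lt_irrefl _ hs

theorem exists_correct {α : Adversary n} {t : ℕ} (h : α ∈ crashContext n t) (ht : t < n) :
    ∃ i, α.Correct i := by
  obtain ⟨i, hi, -⟩ := exists_correct_of_ncard_lt (α := α) (s := ∅)
    (by rw [Set.empty_union]; exact lt_of_le_of_lt h ht)
  exact ⟨i, hi⟩

theorem mem_crashContext_of_subset {α : Adversary n} {t : ℕ} {s : Set (Fin n)}
    (hs : {i | ¬ α.Correct i} ⊆ s) (h : s.ncard ≤ t) : α ∈ crashContext n t :=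
  (Set.ncard_le_ncard hs s.toFinite).trans h

end Adversary

/-! ### Decisions of arbitrary protocols as functions of views. -/

namespace Protocol

variable {n : ℕ}

open Adversary

/-- In every protocol the state of a process is a function of its full-information view. -/
theorem state_eq_of_view (P : Protocol n) {α β : Adversary n} {m : ℕ} {i : Fin n}
    (h : α.view m i = β.view m i) : P.state α m i = P.state β m i := by
  induction m generalizing i with
  | zero =>
    have h0 : (i, α.input i) ∈ (β.view 0 i).labels := h ▸ mem_labels_zero.2 rfl
    rw [state, state, labels_sound h0]
  | succ m ih =>
    rw [state, state, ih (view_eq_of_le h (by omega))]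
    congr 1
    funext j
    by_cases hj : j ≠ i
    · by_cases he : α.pattern.edge j m i
      · rw [if_pos ⟨hj, he⟩, if_pos ⟨hj, (edge_iff_of_view h hj).1 he⟩, ih (view_eq_of_edge h hj he)]
      · rw [if_neg (fun h => he h.2), if_neg (fun h' => he ((edge_iff_of_view h hj).2 h'.2))]
    · rw [if_neg (fun h => hj h.1), if_neg (fun h => hj h.1)]

theorem DecidesAt.congr {P : Protocol n} {α β : Adversary n} {i : Fin n} {m : ℕ} {v : Fin 2}
    (h : P.DecidesAt α i m v) (hv : α.view m i = β.view m i) (hβ : β.Active i m) :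
    P.DecidesAt β i m v := by
  refine ⟨hβ, ?_, fun k hk => ?_⟩
  · rw [← P.state_eq_of_view hv]; exact h.2.1
  · rw [← P.state_eq_of_view (view_eq_of_le hv hk.le)]; exact h.2.2 k hk

theorem DecidesAt.congr_le {P : Protocol n} {α β : Adversary n} {i : Fin n} {m k : ℕ} {v : Fin 2}
    (h : P.DecidesAt α i k v) (hk : k ≤ m) (hv : α.view m i = β.view m i) (hβ : β.Active i m) :
    P.DecidesAt β i k v :=
  h.congr (view_eq_of_le hv hk) (hβ.of_le hk)

/-- Process `i` decides at time `m` or earlier. -/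
def DecidesBy (P : Protocol n) (α : Adversary n) (i : Fin n) (m : ℕ) : Prop :=
  ∃ k ≤ m, ∃ v, P.DecidesAt α i k v

theorem decidesBy_of_decide {P : Protocol n} {α : Adversary n} {i : Fin n} {m : ℕ}
    (hi : α.Active i m) (h : ∃ k ≤ m, P.decide i (P.state α k i) ≠ none) :
    P.DecidesBy α i m := by
  classical
  obtain ⟨hk, hd⟩ := Nat.find_spec h
  obtain ⟨v, hv⟩ := Option.ne_none_iff_exists'.1 hd
  refine ⟨Nat.find h, hk, v, hi.of_le hk, hv, fun l hl => ?_⟩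
  by_contra hc
  exact Nat.find_min h hl ⟨by omega, hc⟩

theorem AllDecisionsBy.of_active {P : Protocol n} {α : Adversary n} {T : ℕ}
    (h : ∀ i, α.Active i T → P.DecidesBy α i T) : P.AllDecisionsBy α T := by
  refine ⟨fun i m v hd => ?_, h⟩
  by_contra! hc
  obtain ⟨k, hk, w, hw⟩ := h i (hd.1.of_le hc.le)
  have := hd.2.2 k (by omega)
  rw [hw.2.1] at this
  exact absurd this (by simp)

end Protocol

/-! ### Knowledge in full-information protocols. -/

open Adversary Protocol

variable {n : ℕ}

theorem fullInfo_state_view (D : Fin n → ℕ → CommGraph n → Option (Fin 2)) (α : Adversary n)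
    (m : ℕ) (i : Fin n) :
    ((fullInfo D).state α m i).time = m ∧ ((fullInfo D).state α m i).view = α.view m i := by
  induction m generalizing i with
  | zero => exact ⟨rfl, rfl⟩
  | succ m ih =>
    refine ⟨congrArg (· + 1) (ih i).1, ?_⟩
    rw [Adversary.view, ← (ih i).2]
    change CommGraph.extend i ((fullInfo D).state α m i).time _ _ = _
    rw [(ih i).1]
    congr 1
    funext j
    rw [← (ih j).2]
    rfl

theorem fullInfo_status (D : Fin n → ℕ → CommGraph n → Option (Fin 2)) (α : Adversary n)
    (m : ℕ) (i : Fin n) : ((fullInfo D).state α m i).status = none ↔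
      ∀ k < m, (fullInfo D).decide i ((fullInfo D).state α k i) = none := by
  induction m with
  | zero => simp [fullInfo, state]
  | succ m ih =>
    rw [Nat.forall_lt_succ_right, ← ih]
    change (((fullInfo D).state α m i).status.or (D i ((fullInfo D).state α m i).time
      ((fullInfo D).state α m i).view)) = none ↔ _ ∧ (if ((fullInfo D).state α m i).status = none
        then D i ((fullInfo D).state α m i).time ((fullInfo D).state α m i).view else none) = none
    rw [Option.or_eq_none_iff]
    constructor
    · rintro ⟨h1, h2⟩; exact ⟨h1, by rw [if_pos h1]; exact h2⟩
    · rintro ⟨h1, h2⟩; exact ⟨h1, by rw [if_pos h1] at h2; exact h2⟩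

theorem fullInfo_localState_eq_iff (D : Fin n → ℕ → CommGraph n → Option (Fin 2))
    {α β : Adversary n} {m : ℕ} {i : Fin n} (hα : α.Active i m) :
    (fullInfo D).localState β m i = (fullInfo D).localState α m i ↔
      β.Active i m ∧ β.view m i = α.view m i := by
  unfold localState
  rw [if_pos hα]
  constructor
  · intro h
    split_ifs at h with hβ
    refine ⟨hβ, ?_⟩
    rw [← (fullInfo_state_view D β m i).2, ← (fullInfo_state_view D α m i).2, Option.some.inj h]
  · rintro ⟨hβ, h⟩
    rw [if_pos hβ, state_eq_of_view _ h]

theorem fullInfo_knows_iff (D : Fin n → ℕ → CommGraph n → Option (Fin 2)) {t : ℕ}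
    {α : Adversary n} {m : ℕ} {i : Fin n} (hα : α.Active i m) (A : Adversary n → ℕ → Prop) :
    (fullInfo D).Knows t i A α m ↔
      ∀ β ∈ crashContext n t, β.Active i m → β.view m i = α.view m i → A β m := by
  unfold Knows
  simp only [fullInfo_localState_eq_iff D hα, and_imp]

theorem fullInfo_knows_existsZero_iff (D : Fin n → ℕ → CommGraph n → Option (Fin 2)) {t : ℕ}
    {α : Adversary n} (hctx : α ∈ crashContext n t) {m : ℕ} {i : Fin n} (hα : α.Active i m) :
    (fullInfo D).Knows t i (ExistsValue 0) α m ↔ α.KnowsZero m i := by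
  rw [fullInfo_knows_iff D hα]
  constructor
  · intro h
    by_contra hc
    obtain ⟨j, hj⟩ := h (α.constInput 1) hctx hα (view_constInput_one hc).symm
    exact absurd hj (by simp [constInput])
  · intro h β _ _ hβ
    exact ((knowsZero_congr hβ).2 h).exists_input

/-- The view of `i` at time `m` implies that some correct process has seen a value `0`. -/
def KnowsCorrectZero (t : ℕ) (α : Adversary n) (m : ℕ) (i : Fin n) : Prop :=
  ∀ β ∈ crashContext n t, β.Active i m → β.view m i = α.view m i →
    ∃ j, β.Correct j ∧ β.KnowsZero m j

/-- The right-hand side does not mention `D`. This removes the circularity of a program whose tests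
refer to its own runs. -/
theorem fullInfo_knows_existsCorrect_iff (D : Fin n → ℕ → CommGraph n → Option (Fin 2)) {t : ℕ}
    {α : Adversary n} {m : ℕ} {i : Fin n} (hα : α.Active i m) :
    (fullInfo D).Knows t i (ExistsCorrect (fullInfo D) t 0) α m ↔ KnowsCorrectZero t α m i := by
  rw [fullInfo_knows_iff D hα]
  refine forall₄_congr fun β hβ _ _ => exists_congr fun j => and_congr_right fun hj => ?_
  exact fullInfo_knows_existsZero_iff D hβ (hj.active m)

theorem KnowsCorrectZero.congr {t : ℕ} {α β : Adversary n} {m : ℕ} {i : Fin n}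
    (h : KnowsCorrectZero t α m i) (hv : α.view m i = β.view m i) : KnowsCorrectZero t β m i := by
  unfold KnowsCorrectZero at h ⊢
  rwa [← hv]

/-- A process active at time `m + 1` has sent its view of time `m` to everybody, and somebody is
correct because `t < n`. -/
theorem knowsCorrectZero_succ {t : ℕ} (ht : t < n) {α : Adversary n} {m : ℕ} {i : Fin n}
    (h : α.KnowsZero m i) : KnowsCorrectZero t α (m + 1) i := by
  intro β hβ hi hv
  obtain ⟨j, hj⟩ := exists_correct hβ ht
  exact ⟨j, hj, ((knowsZero_congr (view_eq_of_le hv (by omega))).2 h).edge (edge_of_active hi j)⟩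

/-- If `i` has just heard of a value `0` from `j` and knows of at least `t - 1` failures, then one
of `i` and `j` is correct. -/
theorem knowsCorrectZero_of_missing {t : ℕ} {α : Adversary n} {m : ℕ} {i j : Fin n}
    (hj : j ≠ i) (he : α.pattern.edge j m i) (h : α.KnowsZero m j) {s : Set (Fin n)}
    (hs : ∀ x ∈ s, x ≠ i ∧ ¬ α.pattern.edge x m i) (hcard : t ≤ s.ncard + 1) :
    KnowsCorrectZero t α (m + 1) i := by
  intro β hβ hi hv
  have hjk : β.KnowsZero m j :=
    (knowsZero_congr (view_eq_of_edge hv.symm hj he)).1 h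
  have hje : β.pattern.edge j m i := (edge_iff_of_view hv hj).2 he
  by_contra! hc
  have hi' : ¬ β.Correct i := fun hcor => hc i hcor (hjk.edge hje)
  have hj' : ¬ β.Correct j := fun hcor => hc j hcor (hjk.mono (by omega))
  have hjs : j ∉ s := fun hmem => (hs j hmem).2 he
  have his : i ∉ insert j s := by
    rintro (h | h)
    · exact hj h.symm
    · exact (hs i h).1 rfl
  -- Were both `i` and `j` faulty, there would be `s.ncard + 2 > t` failures.
  have hsub : insert i (insert j s) ⊆ {x | ¬ β.Correct x} := by
    rintro x (rfl | rfl | hx)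
    · exact hi'
    · exact hj'
    · exact not_correct_of_not_edge fun hb => (hs x hx).2 ((edge_iff_of_view hv (hs x hx).1).1 hb)
  have := (Set.ncard_le_ncard hsub (Set.toFinite _)).trans hβ
  rw [Set.ncard_insert_of_notMem his, Set.ncard_insert_of_notMem hjs] at this
  omega

/-! ### Existence of an implementation. -/

open Classical in
/-- A decision rule implementing `u-Opt₀`. -/
noncomputable def uOptZeroRule (t : ℕ) (i : Fin n) (m : ℕ) (G : CommGraph n) : Option (Fin 2) :=
  if ∀ β ∈ crashContext n t, β.Active i m → β.view m i = G → ∃ j, β.Correct j ∧ β.KnowsZero m j then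
    some 0
  else if (¬ ∃ j, (j, 0) ∈ G.labels) ∧ ∃ k ≤ m, G.TimeRevealed k then some 1
  else none

theorem isUOptZero_iff {t : ℕ} {D : Fin n → ℕ → CommGraph n → Option (Fin 2)} :
    IsUOptZero t D ↔ ∀ α ∈ crashContext n t, ∀ i m, α.Active i m →
      ((fullInfo D).state α m i).status = none →
        (D i m (α.view m i) = some 0 ↔ KnowsCorrectZero t α m i) ∧
        (D i m (α.view m i) = some 1 ↔ ¬ KnowsCorrectZero t α m i ∧ ¬ α.KnowsZero m i ∧
          ∃ k ≤ m, (α.view m i).TimeRevealed k) := by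
  unfold IsUOptZero
  refine forall₅_congr fun α hα i m hi => ?_
  have key : ∀ s, s = (fullInfo D).state α m i → FipState.view s = α.view m i := by
    rintro _ rfl
    exact (fullInfo_state_view D α m i).2
  rw [fullInfo_knows_existsCorrect_iff D hi, fullInfo_knows_existsZero_iff D hα hi]
  constructor
  · intro h hs
    have := h _ rfl hs
    rwa [key _ rfl] at this
  · rintro h s hs hn
    rw [key s hs]
    subst hs
    exact h hn

theorem isUOptZero_uOptZeroRule (t : ℕ) : IsUOptZero t (uOptZeroRule (n := n) t) := by
  classical
  rw [isUOptZero_iff]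
  intro α _ i m _ _
  have h : uOptZeroRule t i m (α.view m i) = if KnowsCorrectZero t α m i then some 0
      else if ¬ α.KnowsZero m i ∧ ∃ k ≤ m, (α.view m i).TimeRevealed k then some 1 else none := by
    unfold uOptZeroRule
    congr
  rw [h]
  split_ifs with h1 h2
  · simp [h1]
  · simpa [h1] using h2
  · simpa [h1] using h2

section uOptZero

variable {t : ℕ} {D : Fin n → ℕ → CommGraph n → Option (Fin 2)}

theorem fullInfo_decide_of_not_decidesBy {α : Adversary n} {i : Fin n} {m : ℕ}
    (hi : α.Active i m) (h : ¬ (fullInfo D).DecidesBy α i m) :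
    ((fullInfo D).state α m i).status = none ∧ D i m (α.view m i) = none := by
  have h1 : ∀ k ≤ m, (fullInfo D).decide i ((fullInfo D).state α k i) = none := by
    intro k hk
    by_contra hc
    exact h (decidesBy_of_decide hi ⟨k, hk, hc⟩)
  have h2 := (fullInfo_status D α m i).2 fun k hk => h1 k hk.le
  refine ⟨h2, ?_⟩
  have h3 := h1 m le_rfl
  change (if _ then D i ((fullInfo D).state α m i).time _ else none) = none at h3
  rwa [if_pos h2, (fullInfo_state_view D α m i).1, (fullInfo_state_view D α m i).2] at h3

theorem fullInfo_decidesAt {α : Adversary n} {i : Fin n} {m : ℕ} {v : Fin 2}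
    (h : (fullInfo D).DecidesAt α i m v) :
    ((fullInfo D).state α m i).status = none ∧ D i m (α.view m i) = some v := by
  have h2 := (fullInfo_status D α m i).2 h.2.2
  refine ⟨h2, ?_⟩
  have h3 := h.2.1
  change (if _ then D i ((fullInfo D).state α m i).time _ else none) = some v at h3
  rwa [if_pos h2, (fullInfo_state_view D α m i).1, (fullInfo_state_view D α m i).2] at h3

namespace IsUOptZero

theorem decidesBy_of_knowsCorrectZero (hD : IsUOptZero t D) {α : Adversary n}
    (hα : α ∈ crashContext n t) {i : Fin n} {m : ℕ} (hi : α.Active i m)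
    (h : KnowsCorrectZero t α m i) : (fullInfo D).DecidesBy α i m := by
  by_contra hc
  obtain ⟨h1, h2⟩ := fullInfo_decide_of_not_decidesBy hi hc
  have := ((isUOptZero_iff.1 hD α hα i m hi h1).1).2 h
  simp [h2] at this

theorem knowsZero_of_revealed (hD : IsUOptZero t D) {α : Adversary n}
    (hα : α ∈ crashContext n t) {i : Fin n} {m : ℕ} (hi : α.Active i m)
    (h : ¬ (fullInfo D).DecidesBy α i m) (hr : ∃ k ≤ m, (α.view m i).TimeRevealed k) :
    α.KnowsZero m i := by
  by_contra hc
  obtain ⟨h1, h2⟩ := fullInfo_decide_of_not_decidesBy hi h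
  have := ((isUOptZero_iff.1 hD α hα i m hi h1).2).2
    ⟨fun hk => h (hD.decidesBy_of_knowsCorrectZero hα hi hk), hc, hr⟩
  simp [h2] at this

end IsUOptZero

end uOptZero

/-! ### Hidden nodes and revealed times. -/

namespace Adversary

/-- A node at time `k + 1` in the view of `(i, m)` shows that `x` did not send in round `k + 1`. -/
def Misses (α : Adversary n) (i : Fin n) (m : ℕ) (x : Fin n) (k : ℕ) : Prop :=
  ∃ y, α.Sees i m y (k + 1) ∧ x ≠ y ∧ ¬ α.pattern.edge x k y

/-- The node `(x, k)` is hidden from `(i, m)`. -/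
def Hidden (α : Adversary n) (i : Fin n) (m : ℕ) (x : Fin n) (k : ℕ) : Prop :=
  ¬ (α.view m i).NodeRevealed x k

variable {α : Adversary n} {i : Fin n} {m : ℕ} {x : Fin n} {k : ℕ}

theorem Hidden.not_sees (h : α.Hidden i m x k) : ¬ α.Sees i m x k :=
  fun hs => h (.inl hs)

theorem Hidden.ne (h : α.Hidden i m x k) (hk : k ≤ m) : x ≠ i := by
  rintro rfl
  exact h.not_sees (α.sees_self x hk)

/-- A process that fails to send in some round is silent in all later rounds. So an omission seen
before time `k` gives a seen node at time `k` that did not hear from `x`: the node `(i, k)` itself,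
or the witness of the omission if `l + 1 = k`. Either would reveal `(x, k)`. -/
theorem Hidden.not_misses (h : α.Hidden i m x k) (hk : k ≤ m) {l : ℕ} (hl : l < k) :
    ¬ α.Misses i m x l := by
  rintro ⟨y, hy, hxy, he⟩
  have key : ∀ z, α.Sees i m z k → x ≠ z → α.pattern.edge x (k - 1) z := by
    intro z hz hxz
    by_contra hc
    obtain ⟨k, rfl⟩ : ∃ k', k = k' + 1 := ⟨k - 1, by omega⟩
    refine h (.inr ⟨k, rfl, z, hz, fun hm => hc ((mem_edges_iff hz hxz).1 hm)⟩)
  rcases Nat.lt_or_ge (l + 1) k with hlk | hlk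
  · exact not_edge_of_not_edge he (by omega) (key i (α.sees_self i hk) (h.ne hk))
  · obtain rfl : k = l + 1 := by omega
    exact he (key y hy hxy)

theorem Hidden.not_edge (h : α.Hidden i m x k) {y : Fin n}
    (hy : α.Sees i m y (k + 1)) (hxy : x ≠ y) : ¬ α.pattern.edge x k y :=
  fun he => h.not_sees (sees_of_edge hy hxy he)

theorem Hidden.misses (h : α.Hidden i m x k) (hk : k < m) : α.Misses i m x k :=
  ⟨i, α.sees_self i hk, h.ne hk.le, h.not_edge (α.sees_self i hk) (h.ne hk.le)⟩

theorem exists_hidden (h : ∀ k ≤ m, ¬ (α.view m i).TimeRevealed k) :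
    ∃ c : ℕ → Fin n, ∀ k ≤ m, α.Hidden i m (c k) k := by
  have : ∀ k, ∃ x, k ≤ m → α.Hidden i m x k := by
    intro k
    by_cases hk : k ≤ m
    · obtain ⟨x, hx⟩ := not_forall.1 (h k hk)
      exact ⟨x, fun _ => hx⟩
    · exact ⟨i, fun h => absurd h hk⟩
  choose c hc using this
  exact ⟨c, hc⟩

/-- If times `0, …, m - 1` all have nodes hidden from `(i, m)`, then `i` is aware of `m` failures in
round `m + 1`. -/
theorem exists_missing (h : ∀ k < m, ¬ (α.view m i).TimeRevealed k) :
    ∃ s : Set (Fin n), s.ncard = m ∧ ∀ x ∈ s, x ≠ i ∧ ∃ k < m, ¬ α.pattern.edge x k i := by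
  have : ∀ k : Fin m, ∃ x, α.Hidden i m x k := fun k => not_forall.1 (h k k.2)
  choose c hc using this
  have hinj : Function.Injective c := by
    intro a b hab
    -- The process `c a` is seen to be silent in round `a + 1`, while a process hidden at the later
    -- time `b` is not seen to omit any message before.
    have key : ∀ a b : Fin m, a < b → c a ≠ c b := by
      intro a b hlt he
      refine (hc b).not_misses b.2.le (l := a) hlt ?_
      rw [← he]
      exact (hc a).misses a.2
    rcases lt_trichotomy a b with h | h | h
    · exact absurd hab (key a b h)
    · exact h
    · exact absurd hab.symm (key b a h)
  refine ⟨Set.range c, ?_, ?_⟩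
  · rw [Set.ncard_range_of_injective hinj, Nat.card_eq_fintype_card, Fintype.card_fin]
  · rintro _ ⟨k, rfl⟩
    have hne := (hc k).ne k.2.le
    exact ⟨hne, k, k.2, (hc k).not_edge (α.sees_self i k.2) hne⟩

theorem exists_revealed (h : α.numFailures < m) : ∃ k < m, (α.view m i).TimeRevealed k := by
  by_contra! hc
  obtain ⟨s, hs, hm⟩ := exists_missing hc
  have hsub : s ⊆ {i | ¬ α.Correct i} := by
    intro x hx
    obtain ⟨-, k, -, he⟩ := hm x hx
    exact not_correct_of_not_edge he
  have : s.ncard ≤ α.numFailures := Set.ncard_le_ncard hsub (Set.toFinite _)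
  omega

/-- If time `k` is revealed to `(i, m)`, which has seen no `0`, then no process active at a time
from `k` on ever sees a `0`. -/
theorem not_knowsZero_of_revealed (hr : (α.view m i).TimeRevealed k) (hk : ¬ α.KnowsZero m i)
    {l : ℕ} (hl : k ≤ l) : ∀ j, α.Active j l → ¬ α.KnowsZero l j := by
  induction l, hl using Nat.le_induction with
  | base =>
    intro j hj hz
    rcases hr j with hs | ⟨l, rfl, y, hy, he⟩
    · exact hk (hz.of_sees hs)
    · by_cases hjy : j = y
      · subst hjy; exact hk (hz.of_sees hy)
      · exact he ((mem_edges_iff hy hjy).2 (edge_of_active hj y))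
  | succ l _ ih =>
    intro j hj hz
    rcases knowsZero_succ.1 hz with hz | ⟨x, -, he, hz⟩
    · exact ih j (hj.of_le (by omega)) hz
    · exact ih x (active_of_edge he) hz

end Adversary

/-! ### Correctness and decision times. -/

namespace IsUOptZero

variable {t : ℕ} {D : Fin n → ℕ → CommGraph n → Option (Fin 2)}

/-- Some time is revealed at time f+1, so a process undecided then has seen a 0; after one more
round `knowsCorrectZero_succ` applies. -/
theorem allDecisionsBy_add_two (hD : IsUOptZero t D) (ht : t < n) {α : Adversary n}
    (hα : α ∈ crashContext n t) : (fullInfo D).AllDecisionsBy α (α.numFailures + 2) := by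
  refine AllDecisionsBy.of_active fun i hi => ?_
  by_cases h : (fullInfo D).DecidesBy α i (α.numFailures + 1)
  · obtain ⟨k, hk, hv⟩ := h
    exact ⟨k, by omega, hv⟩
  · obtain ⟨k, hk, hr⟩ := exists_revealed (i := i) (Nat.lt_succ_self α.numFailures)
    exact hD.decidesBy_of_knowsCorrectZero hα hi (knowsCorrectZero_succ ht
      (hD.knowsZero_of_revealed hα (hi.of_le (by omega)) h ⟨k, hk.le, hr⟩))

/-- A process undecided at time f+1 must have received its first 0 in round f+1, from some `j`.
Being undecided without a 0 at time f, it had no revealed time then, hence is aware of f ≥ t-1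
failures, and `knowsCorrectZero_of_missing` makes it decide after all. -/
theorem allDecisionsBy_add_one (hD : IsUOptZero t D) (ht : t < n) {α : Adversary n}
    (hα : α ∈ crashContext n t) (hf : t ≤ α.numFailures + 1) :
    (fullInfo D).AllDecisionsBy α (α.numFailures + 1) := by
  refine AllDecisionsBy.of_active fun i hi => ?_
  by_contra h
  obtain ⟨k, hk, hr⟩ := exists_revealed (i := i) (Nat.lt_succ_self α.numFailures)
  have hz := hD.knowsZero_of_revealed hα hi h ⟨k, hk.le, hr⟩
  have hkc : ¬ KnowsCorrectZero t α (α.numFailures + 1) i :=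
    fun hc => h (hD.decidesBy_of_knowsCorrectZero hα hi hc)
  rcases knowsZero_succ.1 hz with hz | ⟨j, hj, he, hz'⟩
  · exact hkc (knowsCorrectZero_succ ht hz)
  · have hz0 : ¬ α.KnowsZero α.numFailures i := fun hz => hkc (knowsCorrectZero_succ ht hz)
    have hun : ∀ k < α.numFailures, ¬ (α.view α.numFailures i).TimeRevealed k := by
      intro k hk hr
      refine hz0 (hD.knowsZero_of_revealed hα (hi.of_le (by omega)) ?_ ⟨k, hk.le, hr⟩)
      rintro ⟨l, hl, hv⟩
      exact h ⟨l, by omega, hv⟩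
    obtain ⟨s, hs, hm⟩ := exists_missing hun
    refine hkc (knowsCorrectZero_of_missing hj he hz' (s := s) (fun x hx => ?_) (by omega))
    obtain ⟨hne, k, hk, he⟩ := hm x hx
    exact ⟨hne, not_edge_of_not_edge he hk⟩

/-- The correct process that has seen a 0 still has it at time `max k m`, which contradicts that
time `k` is revealed to a process without 0. -/
theorem not_decides_both (hD : IsUOptZero t D) {α : Adversary n}
    (hα : α ∈ crashContext n t) {i j : Fin n} {m l : ℕ} (hi : (fullInfo D).DecidesAt α i m 0)
    (hj : (fullInfo D).DecidesAt α j l 1) : False := by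
  obtain ⟨hi1, hi2⟩ := fullInfo_decidesAt hi
  obtain ⟨hj1, hj2⟩ := fullInfo_decidesAt hj
  obtain ⟨p, hp, hpz⟩ :=
    ((isUOptZero_iff.1 hD α hα i m hi.1 hi1).1).1 hi2 α hα hi.1 rfl
  obtain ⟨-, hjz, k, hk, hr⟩ := ((isUOptZero_iff.1 hD α hα j l hj.1 hj1).2).1 hj2
  exact not_knowsZero_of_revealed hr hjz (l := max k m) (le_max_left _ _) p (hp.active _)
    (hpz.mono (le_max_right _ _))

theorem solvesUniformConsensus (hD : IsUOptZero t D) (ht : t < n) :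
    (fullInfo D).SolvesUniformConsensus t := by
  intro α hα
  have hdec : ∀ i, α.Correct i → ∃ m v, (fullInfo D).DecidesAt α i m v := by
    intro i hi
    obtain ⟨m, -, v, h⟩ := (hD.allDecisionsBy_add_two ht hα).2 i (hi.active _)
    exact ⟨m, v, h⟩
  refine ⟨hdec, fun v hv i hi => ?_, fun i j m m' v v' hi hj => ?_⟩
  · obtain ⟨m, w, hw⟩ := hdec i hi
    refine ⟨m, ?_⟩
    obtain ⟨h1, h2⟩ := fullInfo_decidesAt hw
    obtain ⟨h3, h4⟩ := isUOptZero_iff.1 hD α hα i m hw.1 h1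
    have h0 : w = 0 → v = 0 := by
      rintro rfl
      obtain ⟨j, -, hj⟩ := h3.1 h2 α hα hw.1 rfl
      obtain ⟨x, hx⟩ := hj.exists_input
      rw [← hv x, hx]
    have h1 : w = 1 → v ≠ 0 := by
      rintro rfl hv0
      exact (h4.1 h2).2.1 ((knowsZero_zero.2 ((hv i).trans hv0)).mono (Nat.zero_le m))
    have : w = v := by omega
    rwa [← this]
  · by_contra hne
    rcases (by omega : (v = 0 ∧ v' = 1) ∨ (v = 1 ∧ v' = 0)) with ⟨rfl, rfl⟩ | ⟨rfl, rfl⟩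
    · exact hD.not_decides_both hα hi hj
    · exact hD.not_decides_both hα hj hi

end IsUOptZero

/-! ### Modifications of adversaries and the views they preserve. -/

namespace Adversary

open Classical in
/-- `x` crashes in round `k + 1` at the latest, and then reaches no process outside `T`. -/
noncomputable def cut (α : Adversary n) (x : Fin n) (k : ℕ) (T : Set (Fin n)) : Adversary n where
  input := α.input
  pattern :=
    { edge := fun y m z => α.pattern.edge y m z ∧ (y = x → m < k ∨ m = k ∧ z ∈ T)
      crashRound := fun y => if y = x then min (α.pattern.crashRound x) (k + 1 : ℕ)
        else α.pattern.crashRound y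
      one_le_crashRound := fun y => by
        split_ifs
        · exact le_min (α.pattern.one_le_crashRound x) (by exact_mod_cast Nat.le_add_left 1 k)
        · exact α.pattern.one_le_crashRound y
      edge_before := fun y m z h => by
        split_ifs at h with hy
        · rw [lt_min_iff, Nat.cast_lt] at h
          subst hy
          exact ⟨α.pattern.edge_before _ _ _ h.1, fun _ => .inl (by omega)⟩
        · exact ⟨α.pattern.edge_before _ _ _ h, fun h => absurd h hy⟩
      no_edge_after := fun y m z h => by
        rintro ⟨he, hx⟩
        split_ifs at h with hy
        · subst hy
          rw [min_lt_iff, Nat.cast_lt] at h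
          rcases h with h | h
          · exact α.pattern.no_edge_after _ _ _ h he
          · have := hx rfl
            omega
        · exact α.pattern.no_edge_after _ _ _ h he }

open Classical in
/-- `p` never crashes. -/
noncomputable def revive (α : Adversary n) (p : Fin n) : Adversary n where
  input := α.input
  pattern :=
    { edge := fun y m z => y = p ∨ α.pattern.edge y m z
      crashRound := fun y => if y = p then ⊤ else α.pattern.crashRound y
      one_le_crashRound := fun y => by
        split_ifs
        · exact le_top
        · exact α.pattern.one_le_crashRound y
      edge_before := fun y m z h => by
        split_ifs at h with hy
        · exact .inl hy
        · exact .inr (α.pattern.edge_before _ _ _ h)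
      no_edge_after := fun y m z h => by
        split_ifs at h with hy
        · exact absurd h (by simp)
        · rintro (he | he)
          · exact hy he
          · exact α.pattern.no_edge_after _ _ _ h he }

open Classical in
/-- Processes in `G` are silent from time `M` on, except that `q` may still reach `j` in round
`M + 1`; all others are correct. -/
noncomputable def trim (α : Adversary n) (M : ℕ) (G : Set (Fin n)) (q j : Fin n) :
    Adversary n where
  input := α.input
  pattern :=
    { edge := fun x m y => x ∈ G → α.pattern.edge x m y ∧ (m < M ∨ m = M ∧ x = q ∧ y = j)
      crashRound := fun x => if x ∈ G then min (α.pattern.crashRound x) (M + 1 : ℕ) else ⊤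
      one_le_crashRound := fun x => by
        split_ifs
        · exact le_min (α.pattern.one_le_crashRound x) (by exact_mod_cast Nat.le_add_left 1 M)
        · exact le_top
      edge_before := fun x m y h hx => by
        rw [if_pos hx, lt_min_iff, Nat.cast_lt] at h
        exact ⟨α.pattern.edge_before _ _ _ h.1, .inl (by omega)⟩
      no_edge_after := fun x m y h he => by
        split_ifs at h with hx
        · obtain ⟨h1, h2⟩ := he hx
          rw [min_lt_iff, Nat.cast_lt] at h
          rcases h with h | h
          · exact α.pattern.no_edge_after _ _ _ h h1
          · omega
        · exact absurd h (by simp) }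

/-- `p` also succeeds in sending to `q` in round `M + 1`. -/
def addEdge (α : Adversary n) (p : Fin n) (M : ℕ) (q : Fin n) (hp : α.Active p M) :
    Adversary n where
  input := α.input
  pattern :=
    { edge := fun y m z => α.pattern.edge y m z ∨ (y = p ∧ m = M ∧ z = q)
      crashRound := α.pattern.crashRound
      one_le_crashRound := α.pattern.one_le_crashRound
      edge_before := fun y m z h => .inl (α.pattern.edge_before _ _ _ h)
      no_edge_after := fun y m z h => by
        rintro (he | ⟨rfl, rfl, rfl⟩)
        · exact α.pattern.no_edge_after _ _ _ h he
        · exact absurd (Order.add_one_le_of_lt hp) (not_le.2 (by exact_mod_cast h)) }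

/-- The input of `q` is replaced by `0`. -/
def zeroInput (α : Adversary n) (q : Fin n) : Adversary n :=
  ⟨Function.update α.input q 0, α.pattern⟩

section surgery

variable {α : Adversary n} {x p q j i : Fin n} {k m M : ℕ} {T G : Set (Fin n)}

/-- Views up to time `M` depend only on the messages of the first `M` rounds. -/
theorem view_eq_of_rounds {α β : Adversary n} (hinput : α.input = β.input)
    (hedge : ∀ k < M, ∀ x y, x ≠ y → (α.pattern.edge x k y ↔ β.pattern.edge x k y)) {m : ℕ}
    (hm : m ≤ M) (i : Fin n) : α.view m i = β.view m i :=
  view_eq_of_closed (fun k _ => k ≤ M) (fun i _ => congrFun hinput i)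
    (fun _ _ (h : _ ≤ M) => by omega) (fun k y x h hx => hedge k h x y hx)
    (fun _ _ _ (h : _ ≤ M) _ _ => by omega) hm

theorem view_eq_of_rounds_succ {α β : Adversary n} (hinput : α.input = β.input)
    (hedge : ∀ k < M, ∀ x y, x ≠ y → (α.pattern.edge x k y ↔ β.pattern.edge x k y)) {i : Fin n}
    (hi : ∀ x, x ≠ i → (α.pattern.edge x M i ↔ β.pattern.edge x M i)) :
    α.view (M + 1) i = β.view (M + 1) i :=
  view_succ_congr (view_eq_of_rounds hinput hedge le_rfl i) hi
    fun x _ _ => view_eq_of_rounds hinput hedge le_rfl x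

theorem view_cut (hm : m ≤ k) (i : Fin n) : (α.cut x k T).view m i = α.view m i :=
  view_eq_of_rounds (M := k) (α := α.cut x k T) (β := α) rfl (fun _ hl _ _ _ => and_iff_left fun _ => .inl hl) hm i

theorem view_cut_succ (hi : i ∈ T ∨ i = x) : (α.cut x k T).view (k + 1) i = α.view (k + 1) i :=
  view_eq_of_rounds_succ (α := α.cut x k T) (β := α) rfl
    (fun _ hl _ _ _ => and_iff_left fun _ => .inl hl) fun _ hy =>
    and_iff_left fun hyx => .inr ⟨rfl, hi.resolve_right fun h => hy (hyx.trans h.symm)⟩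

theorem correct_cut (hi : i ≠ x) : (α.cut x k T).Correct i ↔ α.Correct i := by
  simp [Correct, cut, hi]

theorem not_correct_cut_subset :
    {i | ¬ (α.cut x k T).Correct i} ⊆ insert x {i | ¬ α.Correct i} := by
  intro i hi
  by_cases h : i = x
  · exact .inl h
  · exact .inr fun hc => hi ((correct_cut h).2 hc)

theorem Active.cut (h : α.Active i m) (hm : i = x → m ≤ k) : (α.cut x k T).Active i m := by
  unfold Active Adversary.cut
  dsimp only
  split_ifs with hi
  · subst hi
    exact lt_min h (by exact_mod_cast Nat.lt_succ_of_le (hm rfl))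
  · exact h

theorem correct_revive_self : (α.revive p).Correct p := by
  simp [Correct, revive]

theorem correct_revive (hi : i ≠ p) : (α.revive p).Correct i ↔ α.Correct i := by
  simp [Correct, revive, hi]

theorem Correct.revive (h : α.Correct i) : (α.revive p).Correct i := by
  by_cases hi : i = p
  · subst hi; exact correct_revive_self
  · exact (correct_revive hi).2 h

theorem not_correct_revive : {i | ¬ (α.revive p).Correct i} = {i | ¬ α.Correct i} \ {p} := by
  ext i
  by_cases hi : i = p
  · subst hi; simp [correct_revive_self]
  · simp [correct_revive hi, hi]

theorem Active.revive (h : α.Active i m) : (α.revive p).Active i m := by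
  by_cases hi : i = p
  · subst hi; exact correct_revive_self.active m
  · simpa [Active, Adversary.revive, hi] using h

theorem edge_revive (hp : α.Active p M) {k : ℕ} (hk : k < M) {x y : Fin n} :
    (α.revive p).pattern.edge x k y ↔ α.pattern.edge x k y :=
  or_iff_right_of_imp fun h => h ▸ edge_of_active (hp.of_le hk) y

theorem view_revive (hp : α.Active p M) (hm : m ≤ M) (i : Fin n) :
    (α.revive p).view m i = α.view m i :=
  view_eq_of_rounds (M := M) (α := α.revive p) (β := α) rfl (fun _ hk _ _ _ => edge_revive hp hk) hm i

theorem view_revive_succ (hp : α.Active p M) (hi : i = p ∨ α.pattern.edge p M i) :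
    (α.revive p).view (M + 1) i = α.view (M + 1) i :=
  view_eq_of_rounds_succ (α := α.revive p) (β := α) rfl
    (fun _ hk _ _ _ => edge_revive hp hk) fun y hy =>
    or_iff_right_of_imp fun h => by
      subst h; exact hi.resolve_left (Ne.symm hy)

theorem correct_trim : (α.trim M G q j).Correct i ↔ i ∉ G := by
  unfold Correct trim
  dsimp only
  split_ifs with h
  · refine iff_of_false (fun hc => ?_) (fun hc => hc h)
    have := hc ▸ min_le_right (α.pattern.crashRound i) ((M + 1 : ℕ) : ℕ∞)
    exact absurd this (by simp)
  · simp [h]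

/-- Here `G` consists of `q` and the processes that `j` does not hear from in round `M + 1`, so
silencing `G` from that round on, except from `q` to `j`, removes no message that `j` receives in
it. The others are active at time `M`, so making them correct changes no earlier round. -/
theorem view_trim (hG : ∀ x, x ∈ G ↔ x ≠ j ∧ (x = q ∨ ¬ α.pattern.edge x M j))
    (hj : α.Correct j) :
    (∀ i, (α.trim M G q j).view M i = α.view M i) ∧
      (α.trim M G q j).view (M + 1) j = α.view (M + 1) j := by
  have hact : ∀ x, x ∉ G → α.Active x M := by
    intro x hx
    by_cases hxj : x = j
    · subst hxj; exact hj.active M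
    · by_contra hc
      exact hx ((hG x).2 ⟨hxj, .inr fun he => hc (active_of_edge he)⟩)
  have hedge : ∀ k < M, ∀ x y, x ≠ y →
      ((α.trim M G q j).pattern.edge x k y ↔ α.pattern.edge x k y) := by
    intro k hk x y _
    constructor
    · intro h
      by_cases hx : x ∈ G
      · exact (h hx).1
      · exact edge_of_active ((hact x hx).of_le hk) y
    · exact fun h _ => ⟨h, .inl hk⟩
  refine ⟨fun i => view_eq_of_rounds (α := α.trim M G q j) (β := α) rfl hedge le_rfl i, 
    view_eq_of_rounds_succ (α := α.trim M G q j) (β := α) rfl hedge ?_⟩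
  intro x hx
  constructor
  · intro h
    by_cases hxG : x ∈ G
    · exact (h hxG).1
    · by_contra hc
      exact hxG ((hG x).2 ⟨hx, .inr hc⟩)
  · intro h hxG
    exact ⟨h, .inr ⟨rfl, (((hG x).1 hxG).2).resolve_right (fun hc => hc h), rfl⟩⟩

end surgery

end Adversary

/-! ### Runs in which a dominating protocol is forced to decide 0. -/

/-- Some process decides `0` in the run of `Q` against `α`. -/
def Protocol.DecidesZero (Q : Protocol n) (α : Adversary n) : Prop :=
  ∃ i m, Q.DecidesAt α i m 0

/-- A process decides as soon as it knows that some correct process has seen a value `0`. -/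
def Protocol.ZeroPrompt (Q : Protocol n) (t : ℕ) : Prop :=
  ∀ α ∈ crashContext n t, ∀ i m, α.Active i m → KnowsCorrectZero t α m i → Q.DecidesBy α i m

/-- The number of failures leaves room for one more failure, and for a further failure or a further
process. -/
def Adversary.HasSlack (t : ℕ) (α : Adversary n) : Prop :=
  α.numFailures + 1 ≤ t ∧ (α.numFailures + 2 ≤ t ∨ t + 2 ≤ n)

theorem Adversary.HasSlack.mem {t : ℕ} {α : Adversary n} (h : α.HasSlack t) :
    α ∈ crashContext n t := by
  have := h.1
  change α.numFailures ≤ t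
  omega

theorem Adversary.HasSlack.of_le {t : ℕ} {α β : Adversary n} (h : α.HasSlack t)
    (hle : β.numFailures ≤ α.numFailures) : β.HasSlack t := by
  unfold HasSlack at h ⊢; omega

theorem Adversary.HasSlack.revive {t : ℕ} {α : Adversary n} (h : α.HasSlack t) (p : Fin n) :
    (α.revive p).HasSlack t := by
  refine h.of_le ?_
  unfold numFailures
  rw [not_correct_revive]
  exact Set.ncard_le_ncard Set.sdiff_subset (Set.toFinite _)

section decidesZero

variable {Q : Protocol n} {t : ℕ}

/-- One link in a chain of runs: `r` has decided by time `m`, and identically in both runs; uniform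
agreement in `β` makes its value 0. Agreement must be uniform because `r` may be faulty. -/
theorem decidesZero_of_view (hQ : Q.SolvesUniformConsensus t) (hp : Q.ZeroPrompt t)
    {α β : Adversary n} (hα : α ∈ crashContext n t) (hβ : β ∈ crashContext n t) {r : Fin n} {m : ℕ}
    (hrα : α.Active r m) (hrβ : β.Active r m) (hv : α.view m r = β.view m r)
    (hk : KnowsCorrectZero t α m r) (h : Q.DecidesZero β) : Q.DecidesZero α := by
  obtain ⟨k, hkm, v, hd⟩ := hp α hα r m hrα hk
  obtain ⟨i, l, hi⟩ := h
  have hv0 : v = 0 := (hQ β hβ).2.2 _ _ _ _ _ _ (hd.congr_le hkm hv hrβ) hi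
  exact ⟨r, k, hv0 ▸ hd⟩

/-- The value decided does not depend on what a single node `(q, M)` has received, if some other
process `j` that has seen a `0` by time `M` is correct. -/
theorem decidesZero_of_vary (hQ : Q.SolvesUniformConsensus t) (hp : Q.ZeroPrompt t) (ht : t < n)
    {α α' : Adversary n} (hs : α.HasSlack t) {q j : Fin n} {M : ℕ}
    (hcrash : α.pattern.crashRound = α'.pattern.crashRound)
    (hinput : ∀ x, (M = 0 → x ≠ q) → α.input x = α'.input x)
    (hedge : ∀ x k y, (k + 1 = M → y ≠ q) → x ≠ y →
      (α.pattern.edge x k y ↔ α'.pattern.edge x k y))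
    (hjq : j ≠ q) (hj : α.Correct j) (hz : α.KnowsZero M j) (h : Q.DecidesZero α') :
    Q.DecidesZero α := by
  have hcor : ∀ x, α.Correct x ↔ α'.Correct x := fun x => by unfold Correct; rw [hcrash]
  have hF : {i | ¬ α'.Correct i} = {i | ¬ α.Correct i} := by ext x; simp [hcor]
  have hα' : α' ∈ crashContext n t := by
    change {i | ¬ α'.Correct i}.ncard ≤ t
    rw [hF]; exact hs.mem
  have hj' := (hcor j).1 hj
  obtain ⟨G, hG⟩ : ∃ G : Set (Fin n), ∀ x, x ∈ G ↔ x ≠ j ∧ (x = q ∨ ¬ α.pattern.edge x M j) :=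
    ⟨{x | x ≠ j ∧ (x = q ∨ ¬ α.pattern.edge x M j)}, fun _ => Iff.rfl⟩
  have hG' : ∀ x, x ∈ G ↔ x ≠ j ∧ (x = q ∨ ¬ α'.pattern.edge x M j) := by
    intro x
    rw [hG]
    refine and_congr_right fun hx => ?_
    rw [hedge x M j (by omega) hx]
  have hzview : α.view M j = α'.view M j := by
    refine view_eq_of_closed (fun k x => k ≤ M ∧ (k = M → x ≠ q)) ?_ ?_ ?_ ?_ ⟨le_rfl, fun _ => hjq⟩
    · exact fun x hx => hinput x fun hM => hx.2 hM.symm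
    · exact fun k x hx => ⟨by omega, by omega⟩
    · exact fun k y x hy hx => hedge x k y hy.2 hx
    · exact fun k y x hy _ _ => ⟨by omega, by omega⟩
  have hz' : α'.KnowsZero M j := (knowsZero_congr hzview).1 hz
  have hGF : G.ncard ≤ α.numFailures + 1 := by
    refine (Set.ncard_le_ncard (t := insert q {i | ¬ α.Correct i}) ?_ (Set.toFinite _)).trans
      (Set.ncard_insert_le _ _)
    intro x hx
    rcases ((hG x).1 hx).2 with h | h
    · exact .inl h
    · exact .inr (not_correct_of_not_edge h)
  have hjG : j ∉ G := fun h => ((hG j).1 h).1 rfl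
  have hqG : q ∈ G := (hG q).2 ⟨hjq.symm, .inl rfl⟩
  have hctx : ∀ γ : Adversary n, γ.trim M G q j ∈ crashContext n t := by
    intro γ
    change {i | ¬ (γ.trim M G q j).Correct i}.ncard ≤ t
    simp only [correct_trim, not_not, Set.ofPred_mem_eq]
    have := hs.1
    omega
  obtain ⟨hvM, hvj⟩ := view_trim (α := α) hG hj
  obtain ⟨hvM', hvj'⟩ := view_trim (α := α') hG' hj'
  have hzB : (α.trim M G q j).KnowsZero M j := (knowsZero_congr (hvM j)).2 hz
  have hzB' : (α'.trim M G q j).KnowsZero M j := (knowsZero_congr (hvM' j)).2 hz'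
  have hjB : ∀ γ : Adversary n, (γ.trim M G q j).Correct j := fun γ => correct_trim.2 hjG
  -- The process `j` cannot tell either run from its trimmed version at time `M + 1`. In the trimmed
  -- runs what `q` received can reach only `j`.
  have h1 : Q.DecidesZero (α'.trim M G q j) :=
    decidesZero_of_view hQ hp (hctx α') hα' ((hjB α').active _) (hj'.active _) hvj'
      (knowsCorrectZero_succ ht hzB') h
  suffices h2 : Q.DecidesZero (α.trim M G q j) from
    decidesZero_of_view hQ hp hs.mem (hctx α) (hj.active _) ((hjB α).active _) hvj.symm
      (knowsCorrectZero_succ ht hz) h2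
  have hedgeB : ∀ x k y, (k + 1 = M → y ≠ q) → x ≠ y →
      ((α.trim M G q j).pattern.edge x k y ↔ (α'.trim M G q j).pattern.edge x k y) :=
    fun x k y hy hx => forall_congr' fun _ => and_congr_left' (hedge x k y hy hx)
  have hqsilent : ∀ {γ : Adversary n} {y k}, M ≤ k → y ≠ j →
      ¬ (γ.trim M G q j).pattern.edge q k y := by
    intro γ y k hk hy he
    have := (he hqG).2
    omega
  -- If one more crash is available, `j` crashes in round `M + 2` without sending. It does not
  -- notice by time `M + 1`, and nobody else ever learns from it what `q` received.
  by_cases hcase : G.ncard + 1 ≤ t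
  · have hctx2 : ∀ γ : Adversary n, (γ.trim M G q j).cut j (M + 1) ∅ ∈ crashContext n t := by
      intro γ
      refine mem_crashContext_of_subset not_correct_cut_subset
        ((Set.ncard_insert_le _ _).trans ?_)
      simpa only [correct_trim, not_not, Set.ofPred_mem_eq] using hcase
    have hview : ∀ γ : Adversary n,
        ((γ.trim M G q j).cut j (M + 1) ∅).view (M + 1) j = (γ.trim M G q j).view (M + 1) j :=
      fun γ => view_cut le_rfl j
    have hact : ∀ γ : Adversary n, ((γ.trim M G q j).cut j (M + 1) ∅).Active j (M + 1) :=
      fun γ => ((hjB γ).active _).cut fun _ => le_rfl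
    have h3 : Q.DecidesZero ((α'.trim M G q j).cut j (M + 1) ∅) :=
      decidesZero_of_view hQ hp (hctx2 α') (hctx α') (hact α') ((hjB α').active _) (hview α')
        ((knowsCorrectZero_succ ht hzB').congr (hview α').symm) h1
    refine decidesZero_of_view hQ hp (hctx α) (hctx2 α) ((hjB α).active _) (hact α) (hview α).symm
      (knowsCorrectZero_succ ht hzB) ?_
    obtain ⟨r, hr⟩ := Adversary.exists_correct (hctx2 α) ht
    have hrj : r ≠ j := by
      rintro rfl
      have h1 := hr.edge (M + 1) r
      have := h1.2 rfl
      simp at this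
    have hrG : r ∉ G := correct_trim.1 ((correct_cut hrj).1 hr)
    have hr' : ((α'.trim M G q j).cut j (M + 1) ∅).Correct r :=
      (correct_cut hrj).2 (correct_trim.2 hrG)
    have hrq : r ≠ q := fun h => hrG (h ▸ hqG)
    refine decidesZero_of_view (r := r) (m := M + 2) hQ hp (hctx2 α) (hctx2 α') (hr.active _)
      (hr'.active _) ?_ (knowsCorrectZero_succ ht ?_) h3
    -- The past of `(r, M + 2)` avoids `q` from time `M` on and `j` after time `M`; `r` has the
    -- value 0 from the message of `j` in round `M + 1`.
    · refine view_eq_of_closed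
        (fun k x => k ≤ M + 2 ∧ (M ≤ k → x ≠ q) ∧ (k = M + 2 → x = r) ∧ (M < k → x ≠ j))
        ?_ ?_ ?_ ?_ ⟨le_rfl, fun _ => hrq, fun _ => rfl, fun _ => hrj⟩
      · exact fun x hx => hinput x fun hM => hx.2.1 hM.le
      · rintro k x ⟨h1, h2, h3, h4⟩
        exact ⟨by omega, fun h => h2 (by omega), by omega, fun h => h4 (by omega)⟩
      · rintro k y x ⟨h1, h2, h3, h4⟩ hx
        exact and_congr_left' (hedgeB x k y (fun h => h2 h.ge) hx)
      · rintro k y x ⟨h1, h2, h3, h4⟩ hx he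
        refine ⟨by omega, ?_, by omega, ?_⟩
        · rintro hk rfl
          exact hqsilent hk (h4 (by omega)) he.1
        · rintro hk rfl
          have := he.2 rfl
          simp at this
          omega
    · refine KnowsZero.edge (j := j) ((knowsZero_congr (view_cut (by omega) j)).2 hzB) ?_
      exact ⟨(hjB α).edge M r, fun _ => .inl (by omega)⟩
  -- Now `G` exhausts the `t` failures, and slack supplies a correct `r` besides `j`. In round `M +
  -- 1` it hears a 0 from `j` and nothing from `G`, so it must decide at time `M + 1`, before `j`
  -- can report on `q`.
  · have hn : t + 2 ≤ n := by
      have := hs.2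
      omega
    obtain ⟨r, hr, hrj⟩ := exists_correct_of_ncard_lt (α := α.trim M G q j) (s := {j}) (by
      refine lt_of_le_of_lt (Set.ncard_union_le _ _) ?_
      have := hctx α
      change {i | ¬ (α.trim M G q j).Correct i}.ncard ≤ t at this
      rw [Set.ncard_singleton]
      omega)
    rw [Set.mem_singleton_iff] at hrj
    have hrG : r ∉ G := correct_trim.1 hr
    have hrq : r ≠ q := fun h => hrG (h ▸ hqG)
    refine decidesZero_of_view (r := r) (m := M + 1) hQ hp (hctx α) (hctx α') (hr.active _)
      ((correct_trim.2 hrG).active _) ?_ (knowsCorrectZero_of_missing (Ne.symm hrj)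
        ((hjB α).edge M r) hzB (s := G) (fun x hx => ⟨fun h => hrG (h ▸ hx), ?_⟩) (by omega)) h1
    · refine view_eq_of_closed
        (fun k x => k ≤ M + 1 ∧ (M ≤ k → x ≠ q) ∧ (M < k → x ≠ j))
        ?_ ?_ ?_ ?_ ⟨le_rfl, fun _ => hrq, fun _ => hrj⟩
      · exact fun x hx => hinput x fun hM => hx.2.1 hM.le
      · rintro k x ⟨h1, h2, h4⟩
        exact ⟨by omega, fun h => h2 (by omega), fun h => h4 (by omega)⟩
      · rintro k y x ⟨h1, h2, h4⟩ hx
        exact hedgeB x k y (fun h => h2 h.ge) hx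
      · rintro k y x ⟨h1, h2, h4⟩ hx he
        refine ⟨by omega, ?_, by omega⟩
        rintro hk rfl
        exact hqsilent hk (h4 (by omega)) he
    · intro he
      obtain ⟨-, h5⟩ := he hx
      rcases h5 with h5 | ⟨-, -, h5⟩
      · omega
      · exact hrj h5

/-- The inputs 1 are changed to 0 one by one, each change affecting a single node `(q, 0)`, until
validity applies. -/
theorem decidesZero_of_input (hQ : Q.SolvesUniformConsensus t) (hp : Q.ZeroPrompt t) (ht : t < n)
    {α : Adversary n} (hs : α.HasSlack t) {j : Fin n} (hj : α.Correct j) (hz : α.input j = 0) :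
    Q.DecidesZero α := by
  induction h : {x | α.input x ≠ 0}.ncard generalizing α with
  | zero =>
    rw [Set.ncard_eq_zero (Set.toFinite _)] at h
    obtain ⟨m, hm⟩ := (hQ α hs.mem).2.1 0
      (fun i => by by_contra hc; exact (h ▸ (show i ∈ {x | α.input x ≠ 0} from hc) : i ∈ (∅ : Set _)))
      j hj
    exact ⟨j, m, hm⟩
  | succ k ih =>
    obtain ⟨q, hq⟩ := Set.nonempty_of_ncard_ne_zero (s := {x | α.input x ≠ 0}) (by omega)
    have hjq : j ≠ q := by rintro rfl; exact hq hz
    refine decidesZero_of_vary (α' := α.zeroInput q) (q := q) (j := j) (M := 0) hQ hp ht hs rfl ?_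
      (fun _ _ _ _ _ => Iff.rfl) hjq hj (knowsZero_zero.2 hz) ?_
    · intro x hx
      simp [zeroInput, hx rfl]
    · refine ih (α := α.zeroInput q) hs hj (by simp [zeroInput, hjq, hz]) ?_
      have : {x | (α.zeroInput q).input x ≠ 0} = {x | α.input x ≠ 0} \ {q} := by
        ext x
        by_cases hx : x = q <;> simp [zeroInput, hx]
      rw [this, Set.ncard_sdiff_singleton_of_mem hq, h]
      rfl

/-- The missing messages of `p` in round `M + 1` are added one by one, each affecting a single node
`(q, M + 1)`. Once none is missing, the run is linked to the one where `p` is correct; there `p`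
itself is a correct process with a 0 at time `M`. -/
theorem decidesZero_of_edge (hQ : Q.SolvesUniformConsensus t) (hp : Q.ZeroPrompt t) (ht : t < n)
    {M : ℕ} (ih : ∀ α : Adversary n, α.HasSlack t → ∀ j, α.Correct j → α.KnowsZero M j →
      Q.DecidesZero α) {α : Adversary n} (hs : α.HasSlack t) {p j : Fin n} (hj : α.Correct j)
    (hpj : p ≠ j) (he : α.pattern.edge p M j) (hz : α.KnowsZero M p) : Q.DecidesZero α := by
  induction h : {q | q ≠ p ∧ ¬ α.pattern.edge p M q}.ncard generalizing α with
  | zero =>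
    have hpM := active_of_edge he
    have hrz : Q.DecidesZero (α.revive p) := ih _ (hs.revive p) p correct_revive_self
      ((knowsZero_congr (view_revive hpM le_rfl p)).2 hz)
    by_cases hpa : α.Active p (M + 1)
    · exact decidesZero_of_view hQ hp hs.mem (hs.revive p).mem hpa hpa.revive
        (view_revive hpa le_rfl p).symm (knowsCorrectZero_succ ht hz) hrz
    rw [Set.ncard_eq_zero (Set.toFinite _)] at h
    have hall : ∀ q, q ≠ p → α.pattern.edge p M q := by
      intro q hq
      by_contra hc
      exact (h ▸ (show q ∈ {q | q ≠ p ∧ ¬ α.pattern.edge p M q} from ⟨hq, hc⟩) :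
        q ∈ (∅ : Set _))
    -- Intermediate run: `p` crashes silently in round `M + 2`. At time `M + 1`, `p` takes it for
    -- the run where it is correct; at time `M + 2`, `j` takes it for `α`, where `p` crashed after
    -- reaching everybody in round `M + 1`.
    have hctx : (α.revive p).cut p (M + 1) ∅ ∈ crashContext n t := by
      refine mem_crashContext_of_subset not_correct_cut_subset
        ((Set.ncard_insert_le _ _).trans ?_)
      exact (hs.revive p).1
    have hpact : ((α.revive p).cut p (M + 1) ∅).Active p (M + 1) :=
      (correct_revive_self.active _).cut fun _ => le_rfl
    have hview : ((α.revive p).cut p (M + 1) ∅).view M p = α.view M p := by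
      rw [view_cut (by omega), view_revive hpM le_rfl]
    have h2 : Q.DecidesZero ((α.revive p).cut p (M + 1) ∅) :=
      decidesZero_of_view hQ hp hctx (hs.revive p).mem hpact (correct_revive_self.active _)
        (view_cut le_rfl p) (knowsCorrectZero_succ ht ((knowsZero_congr hview).2 hz)) hrz
    refine decidesZero_of_view (r := j) (m := M + 2) hQ hp hs.mem hctx (hj.active _)
      ((hj.revive.active _).cut fun h => absurd h.symm hpj) ?_
      (knowsCorrectZero_succ ht (hz.edge he)) h2
    refine view_eq_of_rounds_succ (α := α) (β := (α.revive p).cut p (M + 1) ∅) rfl ?_ ?_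
    · intro k hk x y hxy
      refine ⟨fun h => ⟨.inr h, fun _ => .inl hk⟩, ?_⟩
      rintro ⟨rfl | h, -⟩
      · rcases Nat.lt_succ_iff_lt_or_eq.1 hk with hk | rfl
        · exact edge_of_active (hpM.of_le hk) y
        · exact hall y hxy.symm
      · exact h
    · intro x _
      refine ⟨fun hx => ⟨.inr hx, fun hxp => ?_⟩, ?_⟩
      · exact absurd (active_of_edge (hxp ▸ hx)) hpa
      · rintro ⟨rfl | h, h'⟩
        · have := h' rfl
          simp at this
        · exact h
  | succ k ihk =>
    obtain ⟨q, hq, hqe⟩ :=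
      Set.nonempty_of_ncard_ne_zero (s := {q | q ≠ p ∧ ¬ α.pattern.edge p M q}) (by omega)
    have hpM := active_of_edge he
    have hjq : j ≠ q := by rintro rfl; exact hqe he
    refine decidesZero_of_vary (α' := α.addEdge p M q hpM) (q := q) (j := j) (M := M + 1) hQ hp ht
      hs rfl (fun _ _ => rfl) ?_ hjq hj (hz.edge he) ?_
    · intro x k y hy _
      refine ⟨Or.inl, ?_⟩
      rintro (h | ⟨-, rfl, rfl⟩)
      · exact h
      · exact absurd rfl (hy rfl)
    · refine ihk (α := α.addEdge p M q hpM) hs hj (.inl he) ?_ ?_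
      · refine (knowsZero_congr (view_eq_of_rounds (M := M) (α := α.addEdge p M q hpM) (β := α) rfl
          ?_ le_rfl p)).2 hz
        intro k hk x y _
        refine or_iff_left ?_
        rintro ⟨-, h, -⟩
        omega
      · have hmem : q ∈ {x | x ≠ p ∧ ¬ α.pattern.edge p M x} := ⟨hq, hqe⟩
        have : {x | x ≠ p ∧ ¬ (α.addEdge p M q hpM).pattern.edge p M x} =
            {x | x ≠ p ∧ ¬ α.pattern.edge p M x} \ {q} := by
          ext x
          simp [addEdge, not_or, and_assoc]
        rw [this, Set.ncard_sdiff_singleton_of_mem hmem, h]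
        rfl

/-- In runs with slack in which some correct process sees a value `0`, the decision is `0`. -/
theorem decidesZero_of_knowsZero (hQ : Q.SolvesUniformConsensus t) (hp : Q.ZeroPrompt t)
    (ht : t < n) (M : ℕ) : ∀ α : Adversary n, α.HasSlack t → ∀ j, α.Correct j → α.KnowsZero M j →
      Q.DecidesZero α := by
  induction M with
  | zero => exact fun α hs j hj hz => decidesZero_of_input hQ hp ht hs hj (knowsZero_zero.1 hz)
  | succ M ih =>
    intro α hs j hj hz
    rcases knowsZero_succ.1 hz with hz | ⟨p, hpj, he, hz⟩
    · exact ih α hs j hj hz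
    · exact decidesZero_of_edge hQ hp ht ih hs hj hpj he hz

/-- In a uniform consensus protocol, a process that decides `0` knows that some correct process has
seen a value `0`. -/
theorem knowsCorrectZero_of_decidesAt (hQ : Q.SolvesUniformConsensus t) (ht : t < n)
    {α : Adversary n} {i : Fin n} {m : ℕ} (h : Q.DecidesAt α i m 0) :
    KnowsCorrectZero t α m i := by
  intro β hβ hi hv
  by_contra! hc
  obtain ⟨r, hr⟩ := Adversary.exists_correct hβ ht
  -- All faulty processes fall silent after time `m`. As `r` is correct, the exceptional link of
  -- `trim` is void, and no 0 ever reaches a correct process.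
  set γ := β.trim m {x | ¬ β.Correct x} r r with hγ
  have hedge : ∀ {x k y}, m ≤ k → γ.pattern.edge x k y → β.Correct x := by
    intro x k y hk he
    by_contra hx
    have := (he hx).2
    rcases this with h | ⟨-, h, -⟩
    · omega
    · exact hx (h ▸ hr)
  have hview : ∀ x, γ.view m x = β.view m x := by
    refine fun x => view_eq_of_rounds (M := m) (α := γ) (β := β) rfl ?_ le_rfl x
    intro k hk x y _
    refine ⟨fun h => ?_, fun h _ => ⟨h, .inl hk⟩⟩
    by_cases hx : β.Correct x
    · exact hx.edge k y
    · exact (h hx).1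
  have hcor : ∀ x, γ.Correct x ↔ β.Correct x := fun x => correct_trim.trans not_not
  have hγctx : γ ∈ crashContext n t := by
    change {x | ¬ γ.Correct x}.ncard ≤ t
    simp only [hcor]
    exact hβ
  have hzero : ∀ k x, β.Correct x → ¬ γ.KnowsZero k x := by
    intro k
    rcases le_total k m with hk | hk
    · exact fun x hx hz => hc x hx ((knowsZero_congr (hview x)).1 (hz.mono hk))
    · induction k, hk using Nat.le_induction with
      | base => exact fun x hx hz => hc x hx ((knowsZero_congr (hview x)).1 hz)
      | succ k hk ih =>
        intro x hx hz
        rcases knowsZero_succ.1 hz with hz | ⟨y, -, he, hz⟩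
        · exact ih x hx hz
        · exact ih y (hedge hk he) hz
  have hiγ : γ.Active i m := by
    unfold Active
    rw [hγ, trim]
    dsimp only
    split_ifs
    · exact lt_min hi (by exact_mod_cast Nat.lt_succ_self m)
    · exact ENat.natCast_lt_top m
  have h0 : Q.DecidesAt γ i m 0 := h.congr ((hview i).trans hv).symm hiγ
  have hrγ := (hcor r).2 hr
  obtain ⟨l, v, hd⟩ := (hQ γ hγctx).1 r hrγ
  have h1 : Q.DecidesAt (γ.constInput 1) r l v :=
    hd.congr (view_constInput_one (hzero l r hr)) hd.1
  obtain ⟨l', hd'⟩ := (hQ (γ.constInput 1) hγctx).2.1 1 (fun _ => rfl) r hrγ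
  have hv1 : v = 1 := (hQ (γ.constInput 1) hγctx).2.2 _ _ _ _ _ _ h1 hd'
  have hv0 : v = 0 := (hQ γ hγctx).2.2 _ _ _ _ _ _ hd h0
  rw [hv1] at hv0
  exact absurd hv0 (by decide)

theorem not_decidesZero_of_decidesAt_one (hQ : Q.SolvesUniformConsensus t) {α : Adversary n}
    (hα : α ∈ crashContext n t) {i : Fin n} {m : ℕ} (h : Q.DecidesAt α i m 1) :
    ¬ Q.DecidesZero α := by
  rintro ⟨j, l, hj⟩
  exact absurd ((hQ α hα).2.2 _ _ _ _ _ _ h hj) (by decide)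

theorem decidesZero_constInput (hQ : Q.SolvesUniformConsensus t) (ht : t < n) {α : Adversary n}
    (hα : α ∈ crashContext n t) : Q.DecidesZero (α.constInput 0) := by
  obtain ⟨r, hr⟩ := Adversary.exists_correct hα ht
  obtain ⟨m, hm⟩ := (hQ (α.constInput 0) hα).2.1 0 (fun _ => rfl) r hr
  exact ⟨r, m, hm⟩

/-- In an indistinguishable run where no correct process has seen a 0, both `i` and the sender `p`
of its 0 are faulty. Making both correct preserves the view of `i`, frees two failures, and leaves a
correct `p` with a 0. -/
theorem not_decidesAt_one_of_knowsZero (hQ : Q.SolvesUniformConsensus t) (hp : Q.ZeroPrompt t)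
    (ht : t < n) {α : Adversary n} (hα : α ∈ crashContext n t) {i : Fin n} {m : ℕ}
    (hk : ¬ KnowsCorrectZero t α m i) (hz : α.KnowsZero m i) : ¬ Q.DecidesAt α i m 1 := by
  intro hd
  cases m with
  | zero =>
    refine not_decidesZero_of_decidesAt_one hQ (α := α.constInput 0) hα (hd.congr ?_ hd.1)
      (decidesZero_constInput hQ ht hα)
    rw [view, view, knowsZero_zero.1 hz]
    rfl
  | succ m =>
    unfold KnowsCorrectZero at hk
    push Not at hk
    obtain ⟨β, hβ, hi, hv, hno⟩ := hk
    have hz := (knowsZero_congr hv).2 hz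
    have hic : ¬ β.Correct i := fun hc => hno i hc hz
    rcases knowsZero_succ.1 hz with hz | ⟨p, hpi, he, hz⟩
    · obtain ⟨j, hj⟩ := Adversary.exists_correct hβ ht
      exact hno j hj (hz.edge (edge_of_active hi j))
    have hpc : ¬ β.Correct p := fun hc => hno p hc (hz.mono (by omega))
    have hpa : β.Active p m := active_of_edge he
    have hcard : ((β.revive i).revive p).numFailures + 2 ≤ t := by
      unfold numFailures
      rw [not_correct_revive, not_correct_revive]
      have h1 := Set.ncard_sdiff_singleton_add_one (s := {x | ¬ β.Correct x}) hic
      have h2 := Set.ncard_sdiff_singleton_add_one (s := {x | ¬ β.Correct x} \ {i}) (a := p)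
        ⟨hpc, hpi⟩
      have h3 : {x | ¬ β.Correct x}.ncard ≤ t := hβ
      omega
    have hs : ((β.revive i).revive p).HasSlack t := ⟨by omega, .inl hcard⟩
    have hview : ((β.revive i).revive p).view (m + 1) i = β.view (m + 1) i :=
      (view_revive_succ hpa.revive (.inr (.inr he))).trans (view_revive hi le_rfl i)
    have hview' : ((β.revive i).revive p).view m p = β.view m p :=
      (view_revive hpa.revive le_rfl p).trans (view_revive hi (by omega) p)
    exact not_decidesZero_of_decidesAt_one hQ hs.mem
      (hd.congr (hview.trans hv).symm hi.revive.revive)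
      (decidesZero_of_knowsZero hQ hp ht m _ hs p correct_revive_self
        ((knowsZero_congr hview').2 hz))

end decidesZero

/-! ### Decisions on 1 by processes that have seen no 0. -/

namespace Adversary

open Classical in
/-- The adversary in which `x` crashes in round `k + 1`, where `k` is the first number with `R x k`,
and then reaches the processes `y` with `e x k y`. -/
noncomputable def ofFailing (v : Fin n → Fin 2) (R : Fin n → ℕ → Prop)
    (e : Fin n → ℕ → Fin n → Prop) : Adversary n where
  input := v
  pattern :=
    { edge := fun x l y => (∀ k ≤ l, ¬ R x k) ∨ ((∀ k < l, ¬ R x k) ∧ e x l y)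
      crashRound := fun x => if h : ∃ k, R x k then ((Nat.find h + 1 : ℕ) : ℕ∞) else ⊤
      one_le_crashRound := fun x => by
        split_ifs
        · exact_mod_cast Nat.le_add_left 1 _
        · exact le_top
      edge_before := fun x l y h => by
        split_ifs at h with hR
        · rw [Nat.cast_lt] at h
          exact .inl fun k hk => Nat.find_min hR (by omega)
        · exact .inl fun k _ hk => hR ⟨k, hk⟩
      no_edge_after := fun x l y h => by
        split_ifs at h with hR
        · rw [Nat.cast_lt] at h
          rintro (h' | ⟨h', -⟩)
          · exact h' (Nat.find hR) (by omega) (Nat.find_spec hR)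
          · exact h' (Nat.find hR) (by omega) (Nat.find_spec hR)
        · exact absurd h (by simp) }

theorem correct_ofFailing {v : Fin n → Fin 2} {R : Fin n → ℕ → Prop}
    {e : Fin n → ℕ → Fin n → Prop} {x : Fin n} :
    (ofFailing v R e).Correct x ↔ ∀ k, ¬ R x k := by
  unfold Correct ofFailing
  dsimp only
  split_ifs with h
  · exact iff_of_false (by simp) (by push Not; exact h)
  · exact iff_of_true rfl (not_exists.1 h)

end Adversary

section decidesZero

variable {Q : Protocol n} {t : ℕ}

/-- All other inputs may be 0. If `t ≥ 1`, `i` may crash before sending anything, so that the others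
see a run with all inputs 0; if `t = 0`, any `j ≠ i` knows that it is correct and must decide at
time 0. -/
theorem not_decidesAt_one_zero (hQ : Q.SolvesUniformConsensus t) (hp : Q.ZeroPrompt t)
    (ht : t < n) (hn : 2 ≤ n) {α : Adversary n} {i : Fin n} : ¬ Q.DecidesAt α i 0 1 := by
  classical
  intro hd
  obtain ⟨j, hj⟩ : ∃ j, j ≠ i := by
    have : Nontrivial (Fin n) := Fin.nontrivial_iff_two_le.2 hn
    exact exists_ne i
  set R : Fin n → ℕ → Prop := fun x _ => x = i ∧ 1 ≤ t with hR
  set γ := ofFailing (Function.update (fun _ => 0) i (α.input i)) R fun _ _ _ => False with hγ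
  have hcor : ∀ x, x ≠ i → γ.Correct x := fun x hx => correct_ofFailing.2 fun _ h => hx h.1
  have hctx : γ ∈ crashContext n t := by
    rcases Nat.eq_zero_or_pos t with rfl | hpos
    · refine mem_crashContext_of_subset (s := ∅) (fun x hx => hx ?_) (by simp)
      exact correct_ofFailing.2 fun _ h => absurd h.2 (by simp)
    · refine mem_crashContext_of_subset (s := {i}) (fun x hx => ?_) (by rw [Set.ncard_singleton]; exact hpos)
      by_contra hc
      exact hx (hcor x hc)
  have hzj : γ.KnowsZero 0 j := knowsZero_zero.2 (by simp [hγ, ofFailing, hj])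
  have hdγ : Q.DecidesAt γ i 0 1 := by
    refine hd.congr ?_ (active_zero γ i)
    rw [view, view]
    simp [hγ, ofFailing]
  refine not_decidesZero_of_decidesAt_one hQ hctx hdγ ?_
  have h0 := decidesZero_constInput hQ ht hctx
  rcases Nat.eq_zero_or_pos t with rfl | hpos
  · refine decidesZero_of_view (β := γ.constInput 0) (r := j) (m := 0) hQ hp hctx hctx
      (active_zero γ j) (active_zero γ j) ?_ ?_ h0
    · rw [view, view, knowsZero_zero.1 hzj]
      rfl
    · intro β hβ _ hv
      refine ⟨j, ?_, (knowsZero_congr hv).2 hzj⟩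
      have h1 : {x | ¬ β.Correct x} = ∅ := by
        rw [← Set.ncard_eq_zero (Set.toFinite _)]
        exact Nat.le_zero.1 hβ
      by_contra hc
      exact (h1 ▸ (show j ∈ {x | ¬ β.Correct x} from hc) : j ∈ (∅ : Set _))
  · refine decidesZero_of_view (β := γ.constInput 0) (r := j) (m := 1) hQ hp hctx hctx
      ((hcor j hj).active 1) ((hcor j hj).active 1) ?_ (knowsCorrectZero_succ ht hzj) h0
    refine view_eq_of_closed (α := γ) (β := γ.constInput 0) (fun _ x => x ≠ i) ?_
      (fun _ _ h => h) (fun _ _ _ _ _ => Iff.rfl) ?_ hj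
    · intro x hx
      simp [hγ, ofFailing, hx, constInput]
    · rintro k x y - - he rfl
      rcases he with h | ⟨-, h⟩
      · exact h k le_rfl ⟨rfl, hpos⟩
      · exact h

/-- A 0 is sent along the hidden nodes `c 0, ..., c (M + 1)` without changing the view of `i`. In
`γ` its carrier `p = c M` is correct, so 0 is decided; in `β`, which `i` cannot tell from `α`, `p`
crashes in round `M + 1` with only its message to `i` lost. It remains to link `β` to `γ`. -/
theorem not_decidesAt_one_of_hidden (hQ : Q.SolvesUniformConsensus t) (hp : Q.ZeroPrompt t)
    (ht : t < n) {α : Adversary n} (hα : α ∈ crashContext n t) {i : Fin n} {M : ℕ} {c : ℕ → Fin n}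
    (hc : ∀ k ≤ M + 1, α.Hidden i (M + 1) (c k) k) : ¬ Q.DecidesAt α i (M + 1) 1 := by
  classical
  intro hd
  have hi : α.Active i (M + 1) := hd.1
  obtain ⟨p, hpc⟩ : ∃ p, p = c M := ⟨_, rfl⟩
  obtain ⟨j, hjc⟩ : ∃ j, j = c (M + 1) := ⟨_, rfl⟩
  set R : Fin n → ℕ → Prop := fun x l => x ≠ p ∧ α.Misses i (M + 1) x l with hR
  -- Each process other than `p` crashes only when `i` has evidence of it, and then still reaches
  -- the seen nodes as in `α` and its successor on the hidden path.
  set γ := ofFailing (Function.update α.input (c 0) 0) R fun x l y =>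
    (α.pattern.edge x l y ∧ α.Sees i (M + 1) y (l + 1)) ∨ (x = c l ∧ y = c (l + 1)) with hγ
  obtain ⟨D, hD⟩ : ∃ D : Set (Fin n), ∀ x, x ∈ D ↔ ∃ l, α.Misses i (M + 1) x l :=
    ⟨{x | ∃ l, α.Misses i (M + 1) x l}, fun _ => Iff.rfl⟩
  have hpD : p ∈ D := (hD p).2 ⟨M, hpc ▸ (hc M (by omega)).misses (by omega)⟩
  have hmiss_le : ∀ {x l}, α.Misses i (M + 1) x l → l ≤ M := by
    rintro x l ⟨y, hy, -⟩
    have := sees_le hy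
    omega
  have hjD : j ∉ D := by
    intro h
    obtain ⟨l, hl⟩ := (hD j).1 h
    rw [hjc] at hl
    have := hmiss_le hl
    exact (hc _ le_rfl).not_misses le_rfl (by omega) hl
  have hiD : i ∉ D := by
    intro h
    obtain ⟨l, hl⟩ := (hD i).1 h
    have := hmiss_le hl
    obtain ⟨y, -, -, he⟩ := hl
    exact he (edge_of_active (hi.of_le (by omega)) y)
  have hij : j ≠ i := hjc ▸ (hc _ le_rfl).ne le_rfl
  have hpi : p ≠ i := fun h => hiD (h ▸ hpD)
  have hpj : p ≠ j := fun h => hjD (h ▸ hpD)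
  have hDt : D.ncard ≤ t := by
    refine (Set.ncard_le_ncard (fun x hx => ?_) (Set.toFinite _)).trans hα
    obtain ⟨l, y, -, -, he⟩ := (hD x).1 hx
    exact not_correct_of_not_edge he
  have hcorγ : ∀ x, γ.Correct x ↔ x ∉ D \ {p} := by
    intro x
    rw [hγ, correct_ofFailing]
    simp only [hR, Set.mem_sdiff, Set.mem_singleton_iff, hD, not_and, not_not]
    constructor
    · rintro h ⟨l, hl⟩
      by_contra hx
      exact h l hx hl
    · exact fun h l hx hl => hx (h ⟨l, hl⟩)
  have hFγ : {x | ¬ γ.Correct x} = D \ {p} := by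
    ext x
    simp only [Set.mem_ofPred_eq, hcorγ, not_not]
  have hnumγ : γ.numFailures + 1 = D.ncard := by
    unfold numFailures
    rw [hFγ, Set.ncard_sdiff_singleton_add_one hpD]
  have hpγ : γ.Correct p := (hcorγ p).2 (by simp)
  have hiγ : γ.Correct i := (hcorγ i).2 fun h => hiD h.1
  have hjγ : γ.Correct j := (hcorγ j).2 fun h => hjD h.1
  have hz : ∀ k ≤ M, γ.KnowsZero k (c k) := by
    intro k
    induction k with
    | zero => exact fun _ => knowsZero_zero.2 (by simp [hγ, ofFailing])
    | succ k ih =>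
      refine fun hk => (ih (by omega)).edge (.inr ⟨fun l hl hm => ?_, .inr ⟨rfl, rfl⟩⟩)
      -- The carrier `c k` is hidden at time `k`, so it does not crash before the round in which it
      -- passes on the 0.
      exact (hc k (by omega)).not_misses (by omega) hl hm.2
  have hzp : γ.KnowsZero M p := hpc ▸ hz M le_rfl
  set β := γ.cut p M {i}ᶜ with hβ
  have hFβ : {x | ¬ β.Correct x} ⊆ D := by
    refine not_correct_cut_subset.trans ?_
    rw [hFγ]
    exact Set.insert_subset hpD Set.sdiff_subset
  have hβctx : β ∈ crashContext n t := mem_crashContext_of_subset hFβ hDt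
  have hview : α.view (M + 1) i = β.view (M + 1) i := by
    refine view_eq_of_closed (fun k x => α.Sees i (M + 1) x k) ?_ (fun _ _ => sees_pred) ?_
      (fun _ _ _ => sees_of_edge) (α.sees_self i le_rfl)
    · intro x hx
      have : x ≠ c 0 := by rintro rfl; exact (hc 0 (by omega)).not_sees hx
      simp [hβ, cut, hγ, ofFailing, this]
    · intro l y x hy hxy
      have hl : l + 1 ≤ M + 1 := sees_le hy
      by_cases hx : x = p
      · subst hx
        rcases Nat.lt_or_ge l M with hlM | hlM
        · refine iff_of_true ?_ ⟨hpγ.edge l y, fun _ => .inl hlM⟩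
          by_contra he
          exact (hpc ▸ hc M (by omega)).not_misses (by omega) hlM ⟨y, hy, hxy, he⟩
        · obtain rfl : l = M := by omega
          obtain rfl : y = i := sees_at hy
          refine iff_of_false ((hpc ▸ hc l (by omega)).not_edge hy hxy) ?_
          rintro ⟨-, h⟩
          have := h rfl
          simp at this
      · have hxβ : β.pattern.edge x l y ↔ γ.pattern.edge x l y :=
          and_iff_left fun h => absurd h hx
        rw [hxβ]
        constructor
        · intro he
          refine .inr ⟨?_, .inl ⟨he, hy⟩⟩
          rintro k hk ⟨-, z, -, -, hz⟩
          exact not_edge_of_not_edge hz hk he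
        · rintro (h | ⟨-, ⟨h, -⟩ | ⟨-, rfl⟩⟩)
          · by_contra he
            exact h l le_rfl ⟨hx, y, hy, hxy, he⟩
          · exact h
          · exact absurd hy (hc _ hl).not_sees
  have hzβ : β.KnowsZero M p := (knowsZero_congr (view_cut le_rfl p)).2 hzp
  have heβ : β.pattern.edge p M j := ⟨hpγ.edge M j, fun _ => .inr ⟨rfl, hij⟩⟩
  by_cases hcase : t ≤ D.ncard
  -- Here `D` has exactly `t` elements, and `i`, `j` lie outside it. At time `M + 1`, `j` cannot
  -- tell `β` from `γ`; it has a 0 from `p` and misses the `t - 1` members of `D \ {p}`, so it must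
  -- decide.
  · have hn : t + 2 ≤ n := by
      have h1 : i ∉ insert j D := by
        rintro (h | h)
        · exact hij h.symm
        · exact hiD h
      have h2 := Set.ncard_le_ncard (Set.subset_univ (insert i (insert j D))) (Set.toFinite _)
      rw [Set.ncard_insert_of_notMem h1, Set.ncard_insert_of_notMem hjD, Set.ncard_univ,
        Nat.card_eq_fintype_card, Fintype.card_fin] at h2
      omega
    have hs : γ.HasSlack t := ⟨by omega, .inr hn⟩
    refine not_decidesZero_of_decidesAt_one hQ hβctx
      (hd.congr hview ((hiγ.active _).cut fun h => absurd h.symm hpi)) ?_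
    refine decidesZero_of_view (r := j) (m := M + 1) hQ hp hβctx hs.mem
      ((hjγ.active _).cut fun h => absurd h.symm hpj) (hjγ.active _)
      (view_cut_succ (.inl hij)) ?_ (decidesZero_of_knowsZero hQ hp ht M γ hs p hpγ hzp)
    refine knowsCorrectZero_of_missing hpj heβ hzβ (s := D \ {p}) (fun x hx => ?_) ?_
    · refine ⟨fun h => hjD (h ▸ hx.1), fun he => ?_⟩
      obtain ⟨l, hl⟩ := (hD x).1 hx.1
      rcases he.1 with h | ⟨-, ⟨-, h⟩ | ⟨h, -⟩⟩
      · exact h l (hmiss_le hl) ⟨hx.2, hl⟩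
      · rw [hjc] at h
        exact (hc _ le_rfl).not_sees h
      · exact hx.2 (h.trans hpc.symm)
    · rw [Set.ncard_sdiff_singleton_add_one hpD]
      exact hcase
  -- With a failure to spare, `i` crashes silently in round `M + 2`. It alone could testify at time
  -- `M + 1` whether `p` crashed in round `M + 1` or silently in round `M + 2`, so `j` cannot
  -- distinguish the two at time `M + 2`.
  · have hs : γ.HasSlack t := ⟨by omega, .inl (by omega)⟩
    have hcard : (insert i D).ncard ≤ t := (Set.ncard_insert_le _ _).trans (by omega)
    have hctx1 : β.cut i (M + 1) ∅ ∈ crashContext n t :=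
      mem_crashContext_of_subset (not_correct_cut_subset.trans (Set.insert_subset_insert hFβ)) hcard
    have hctx2 : (γ.cut p (M + 1) ∅).cut i (M + 1) ∅ ∈ crashContext n t := by
      refine mem_crashContext_of_subset (not_correct_cut_subset.trans
        (Set.insert_subset_insert (not_correct_cut_subset.trans ?_))) hcard
      rw [hFγ]
      exact Set.insert_subset hpD Set.sdiff_subset
    have hiβ : (β.cut i (M + 1) ∅).Active i (M + 1) :=
      ((hiγ.active _).cut fun h => absurd h.symm hpi).cut fun _ => le_rfl
    refine not_decidesZero_of_decidesAt_one hQ hctx1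
      (hd.congr (hview.trans (view_cut le_rfl i).symm) hiβ) ?_
    have hv2 : ∀ {k}, k ≤ M + 1 → ((γ.cut p (M + 1) ∅).cut i (M + 1) ∅).view k p = γ.view k p :=
      fun hk => (view_cut hk p).trans (view_cut hk p)
    have h2 : Q.DecidesZero ((γ.cut p (M + 1) ∅).cut i (M + 1) ∅) :=
      decidesZero_of_view hQ hp hctx2 hs.mem
        (((hpγ.active _).cut fun _ => le_rfl).cut fun h => absurd h hpi) (hpγ.active _)
        (hv2 le_rfl) (knowsCorrectZero_succ ht ((knowsZero_congr (hv2 (by omega))).2 hzp))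
        (decidesZero_of_knowsZero hQ hp ht M γ hs p hpγ hzp)
    refine decidesZero_of_view (r := j) (m := M + 2) hQ hp hctx1 hctx2
      (((hjγ.active _).cut fun h => absurd h.symm hpj).cut fun h => absurd h hij)
      (((hjγ.active _).cut fun h => absurd h.symm hpj).cut fun h => absurd h hij) ?_
      (knowsCorrectZero_succ ht ((knowsZero_congr (view_cut le_rfl j)).2 (hzβ.edge heβ))) h2
    refine view_eq_of_closed (α := β.cut i (M + 1) ∅) (β := (γ.cut p (M + 1) ∅).cut i (M + 1) ∅)
      (fun k x => k ≤ M + 2 ∧ (M < k → x ≠ i) ∧ (k = M + 2 → x = j)) (fun _ _ => rfl) ?_ ?_ ?_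
      ⟨le_rfl, fun _ => hij, fun _ => rfl⟩
    · rintro k x ⟨h1, h2, h3⟩
      exact ⟨by omega, fun h => h2 (by omega), by omega⟩
    · rintro k y x ⟨h1, h2, h3⟩ -
      refine and_congr_left' (and_congr_right' (forall_congr' fun _ => ?_))
      simp only [Set.mem_compl_iff, Set.mem_singleton_iff, Set.mem_empty_iff_false, and_false,
        or_false]
      constructor
      · omega
      · intro hk
        rcases Nat.lt_succ_iff_lt_or_eq.1 hk with hk | rfl
        · exact .inl hk
        · exact .inr ⟨rfl, h2 (by omega)⟩
    · rintro k y x ⟨h1, h2, h3⟩ - he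
      refine ⟨by omega, ?_, by omega⟩
      rintro hk rfl
      have := he.2 rfl
      simp at this
      omega

end decidesZero

/-! ### Unbeatability. -/

theorem IsUOptZero.dominates {t : ℕ} (ht : t < n) (hn : 2 ≤ n)
    {D : Fin n → ℕ → CommGraph n → Option (Fin 2)} (hD : IsUOptZero t D) {Q : Protocol n}
    (hQ : Q.SolvesUniformConsensus t) (hdom : Dominates t Q (fullInfo D)) :
    Dominates t (fullInfo D) Q := by
  have hp : Q.ZeroPrompt t := by
    intro α hα i m hi hk
    obtain ⟨k, hkm, v, hv⟩ := hD.decidesBy_of_knowsCorrectZero hα hi hk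
    obtain ⟨l, hl, w, hw⟩ := hdom α hα i k v hv
    exact ⟨l, hl.trans hkm, w, hw⟩
  intro α hα i m v hd
  by_contra hc
  have hk : ¬ KnowsCorrectZero t α m i :=
    fun hk => hc (hD.decidesBy_of_knowsCorrectZero hα hd.1 hk)
  obtain rfl | rfl : v = 0 ∨ v = 1 := by omega
  · exact hk (knowsCorrectZero_of_decidesAt hQ ht hd)
  · by_cases hz : α.KnowsZero m i
    · exact not_decidesAt_one_of_knowsZero hQ hp ht hα hk hz hd
    · cases m with
      | zero => exact not_decidesAt_one_zero hQ hp ht hn hd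
      | succ M =>
        obtain ⟨c, hc⟩ := exists_hidden (α := α) (i := i) (m := M + 1) fun k hk hr =>
          hz (hD.knowsZero_of_revealed hα hd.1 hc ⟨k, hk, hr⟩)
        exact not_decidesAt_one_of_hidden hQ hp ht hα hc hd

theorem mainTheorem2 (n t : ℕ) (hn : 2 ≤ n) (ht : t < n) :
    (∃ D : Fin n → ℕ → CommGraph n → Option (Fin 2), IsUOptZero t D) ∧
    ∀ D : Fin n → ℕ → CommGraph n → Option (Fin 2), IsUOptZero t D →
      (fullInfo D).IsUnbeatableUniformConsensus t ∧
      ∀ α ∈ crashContext n t,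
        (fullInfo D).AllDecisionsBy α (α.numFailures + 2) ∧
        (t ≤ α.numFailures + 1 → (fullInfo D).AllDecisionsBy α (α.numFailures + 1)) := by
  refine ⟨⟨_, isUOptZero_uOptZeroRule t⟩, fun D hD => ⟨⟨hD.solvesUniformConsensus ht, ?_⟩, ?_⟩⟩
  · rintro ⟨Q, hQ, hdom, hnot⟩
    exact hnot (hD.dominates ht hn hQ hdom)
  · exact fun α hα => ⟨hD.allDecisionsBy_add_two ht hα, hD.allDecisionsBy_add_one ht hα⟩
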